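/- For a finite simple graph $\Gamma$ on $n$ vertices, without isolated vertices, let $Q_v^{t}$ be the distribution after $t$ steps of the random walk on $\Gamma$ that starts at the vertex $v$ and in each step moves to a uniformly random neighbour of the current vertex. Let $U$ be the uniform distribution on the vertex set, and let $\|P_1-P_2\|=\frac12\sum_{j}|P_1(j)-P_2(j)|$ be the total variation distance. Theorem. There is a deterministic algorithm which takes as input (the adjacency matrix of) a finite simple graph $\Gamma$ on vertex set $\{0,\dots,n-1\}$, halts within a number of steps bounded by a fixed polynomial in $n$, and has the following property. Whenever $n\ge 1$, $\epsilon\in(0,\frac25)$ is a real number, $D\ge 1$ and $\tau\ge1$ are integers, the input graph $\Gamma$ is $D$-regular, and $\|Q_v^{\tau}-U\|<\frac1{30}$ for at least $\epsilon n$ vertices $v$ of $\Gamma$, the output of the algorithm is the list of vertices, in cyclic order, of a cycle of $\Gamma$ of length greater than $\frac{\epsilon n}{40\tau}$. (No lower bound on $D$ in terms of $\tau$ is assumed. The algorithm and the polynomial do not depend on $\epsilon,D,\tau$. The computational model is a deterministic random access machine with unit-cost steps whose only arithmetic operations on natural numbers are addition and truncated subtraction.) -/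

import Mathlib

/-! ## Random walks on graphs -/

/-- Transition matrix of the nearest-neighbour random walk: from `i`, move to a uniformly random
neighbour of `i`. -/
noncomputable def walkMatrix {n : ℕ} (Γ : SimpleGraph (Fin n)) [DecidableRel Γ.Adj] :
    Matrix (Fin n) (Fin n) ℝ :=
  Matrix.of fun i j => if Γ.Adj i j then 1 / (Γ.degree i : ℝ) else 0

/-- `walkDist Γ v t` is the distribution `Q_v^t` of the random walk started at `v` after `t`
steps; `walkDist Γ v t j` is the probability of being at `j`. -/
noncomputable def walkDist {n : ℕ} (Γ : SimpleGraph (Fin n)) [DecidableRel Γ.Adj]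
    (v : Fin n) (t : ℕ) : Fin n → ℝ :=
  (walkMatrix Γ ^ t) v

/-- The uniform distribution on `Fin n`. -/
noncomputable def unifDist (n : ℕ) : Fin n → ℝ := fun _ => 1 / (n : ℝ)

/-- Total variation distance. -/
noncomputable def tvDist {n : ℕ} (P Q : Fin n → ℝ) : ℝ := (1 / 2) * ∑ j, |P j - Q j|

/-! ## A deterministic random access machine with a step count

A machine has registers `R[0], R[1], …` (addressed directly by the program) and memory cells
`M[0], M[1], …` (addressed indirectly), all holding natural numbers. The arithmetic is addition
and truncated subtraction only (no multiplication), so that the number of steps is polynomially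
related to the running time of a Turing machine. -/

namespace RAM

/-- Contents of the registers and of the memory. -/
structure State where
  reg : ℕ → ℕ
  mem : ℕ → ℕ

/-- Elementary instructions. -/
inductive Instr where
  /-- `R[i] := c` -/
  | const (i c : ℕ)
  /-- `R[i] := R[j]` -/
  | copy (i j : ℕ)
  /-- `R[i] := R[j] + R[k]` -/
  | add (i j k : ℕ)
  /-- `R[i] := R[j] - R[k]`, and `0` if `R[j] < R[k]` -/
  | sub (i j k : ℕ)
  /-- `R[i] := M[R[j]]` -/
  | load (i j : ℕ)
  /-- `M[R[i]] := R[j]` -/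
  | store (i j : ℕ)

/-- Effect of an elementary instruction. -/
def Instr.exec : Instr → State → State
  | .const i c, s => { s with reg := Function.update s.reg i c }
  | .copy i j, s => { s with reg := Function.update s.reg i (s.reg j) }
  | .add i j k, s => { s with reg := Function.update s.reg i (s.reg j + s.reg k) }
  | .sub i j k, s => { s with reg := Function.update s.reg i (s.reg j - s.reg k) }
  | .load i j, s => { s with reg := Function.update s.reg i (s.mem (s.reg j)) }
  | .store i j, s => { s with mem := Function.update s.mem (s.reg i) (s.reg j) }

/-- Programs. -/
inductive Prog where
  /-- do nothing -/
  | skip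
  /-- an elementary instruction -/
  | instr (a : Instr)
  /-- first `p`, then `q` -/
  | seq (p q : Prog)
  /-- if `R[i] ≠ 0` then `p` else `q` -/
  | ite (i : ℕ) (p q : Prog)
  /-- while `R[i] ≠ 0` do `p` -/
  | loop (i : ℕ) (p : Prog)

/-- One step of the machine. A configuration consists of the list of program parts still to be
executed and the state; it is halted when the list is empty. -/
def step : List Prog × State → List Prog × State
  | ([], s) => ([], s)
  | (.skip :: k, s) => (k, s)
  | (.instr a :: k, s) => (k, a.exec s)
  | (.seq p q :: k, s) => (p :: q :: k, s)
  | (.ite i p q :: k, s) => if s.reg i ≠ 0 then (p :: k, s) else (q :: k, s)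
  | (.loop i p :: k, s) => if s.reg i ≠ 0 then (p :: .loop i p :: k, s) else (k, s)

/-- Program `P`, started in state `s₀`, halts after at most `T` steps, in state `s`. -/
def HaltsWithin (P : Prog) (s₀ : State) (T : ℕ) (s : State) : Prop :=
  ∃ t ≤ T, step^[t] ([P], s₀) = ([], s)

/-- Input state for a graph on `Fin n`: `R[0] = n`, and the adjacency matrix is stored row by row
in `M[0], …, M[n² - 1]`; all other registers and cells are `0`. -/
def graphInput {n : ℕ} (Γ : SimpleGraph (Fin n)) [DecidableRel Γ.Adj] : State where
  reg := fun i => if i = 0 then n else 0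
  mem := fun a => if ∃ i j : Fin n, Γ.Adj i j ∧ a = n * (i : ℕ) + (j : ℕ) then 1 else 0

/-- Output list: its length is `R[0]`, and its entries are in consecutive cells from address
`R[1]` on. -/
def State.output (s : State) : List ℕ :=
  (List.range (s.reg 0)).map fun i => s.mem (s.reg 1 + i)

end RAM

/-!
The algorithm computes a *normal* rooted forest of `Γ`, in which every edge of `Γ` joins a vertex to
one of its ancestors, as depth-first search would. It does so by local search: as long as there is
an edge `uv` such that `v` is not deeper than `u` and not an ancestor of `u`, the vertex `v` is hung
under `u` together with its subtree. No depth decreases and that of `v` increases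
(`IsParent.totalDepth_lt_update`), and all depths are at most `n`, so there are `O(n ^ 2)` changes.
An edge from `u` to its `k`-th ancestor, `k ≥ 2`, closes a cycle of length `k + 1`
(`IsParent.exists_cycle`), and the output is a longest cycle of this kind, of length `L`, say.

The number `L` is large enough although the algorithm knows neither `ε` nor `τ`. Let `x` be a
deepest vertex of the forest, or its virtual root, such that the subtree at `x` contains at least
half of all vertices. Then `x`, together with its nearest `L - 1` ancestors, is a set `S` of at
most `L` vertices whose removal leaves only components with at most `n / 2` vertices
(`IsParent.exists_separator`). If the walk from `v` is
well mixed at time `τ`, then it has left the component of `v` with probability at least `13 / 30`,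
and therefore has visited `S`. On the other hand, by regularity the walk matrix is doubly
stochastic, so that the walks from all `n` starting points together make `(τ + 1) * |S|` visits to
`S` in expectation up to time `τ`. Comparing the two counts (`card_mixing_le`) gives
`13 * ε * n ≤ 30 * (τ + 1) * L`, which is stronger than the claim. That there is a cycle at all
follows from a look at a deepest vertex if the degree is at least `2`
(`IsNormal.exists_long_back_edge`); for degree `1` the walk does not mix (`le_tvDist_of_matching`).

Programs of the random access machine are treated with a Hoare logic with time bounds
(`RAM.Ends`, `RAM.ends_loop`), in which the time bounds of the pieces add up to a polynomial.
-/

/-! ### Timed correctness for the random access machine -/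

namespace RAM

/-- From the state `s`, the program `P` finishes in at most `T` steps, in a state with property
`Q`. The statement quantifies over the continuation `k`, so that it composes. -/
def Ends (P : Prog) (s : State) (T : ℕ) (Q : State → Prop) : Prop :=
  ∃ t ≤ T, ∃ s', (∀ k, step^[t] (P :: k, s) = (k, s')) ∧ Q s'

variable {p q : Prog} {s : State} {T T₁ T₂ i : ℕ} {Q R : State → Prop}

lemma Ends.mono (h : Ends p s T₁ R) (hT : T₁ ≤ T₂) (hQ : ∀ s', R s' → Q s') :
    Ends p s T₂ Q := by
  obtain ⟨t, ht, s', hs, hR⟩ := h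
  exact ⟨t, ht.trans hT, s', hs, hQ _ hR⟩

lemma Ends.le (h : Ends p s T₁ Q) (hT : T₁ ≤ T₂) : Ends p s T₂ Q :=
  h.mono hT fun _ h => h

lemma ends_skip (h : Q s) : Ends .skip s 1 Q :=
  ⟨1, le_rfl, s, fun _ => rfl, h⟩

lemma ends_instr {a : Instr} (h : Q (a.exec s)) : Ends (.instr a) s 1 Q :=
  ⟨1, le_rfl, a.exec s, fun _ => rfl, h⟩

lemma Ends.seq (hp : Ends p s T₁ R) (hq : ∀ s', R s' → Ends q s' T₂ Q) :
    Ends (.seq p q) s (T₁ + T₂ + 1) Q := by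
  obtain ⟨t₁, ht₁, s₁, hs₁, hR⟩ := hp
  obtain ⟨t₂, ht₂, s₂, hs₂, hQ⟩ := hq s₁ hR
  refine ⟨t₂ + t₁ + 1, by omega, s₂, fun k => ?_, hQ⟩
  rw [Function.iterate_succ_apply, Function.iterate_add_apply]
  simp only [step]
  rw [hs₁, hs₂]

lemma ends_ite (hp : s.reg i ≠ 0 → Ends p s T Q) (hq : s.reg i = 0 → Ends q s T Q) :
    Ends (.ite i p q) s (T + 1) Q := by
  by_cases h : s.reg i = 0
  · obtain ⟨t, ht, s', hs, hQ⟩ := hq h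
    refine ⟨t + 1, by omega, s', fun k => ?_, hQ⟩
    rw [Function.iterate_succ_apply, ← hs k]
    simp [step, h]
  · obtain ⟨t, ht, s', hs, hQ⟩ := hp h
    refine ⟨t + 1, by omega, s', fun k => ?_, hQ⟩
    rw [Function.iterate_succ_apply, ← hs k]
    simp [step, h]

/-- The rule for loops, with invariant `I` and a variant `m` that bounds the number of rounds. -/
lemma ends_loop {I : ℕ → State → Prop}
    (hbody : ∀ m s, I m s → s.reg i ≠ 0 → Ends p s T (fun s' => ∃ m' < m, I m' s'))
    (hexit : ∀ m s, I m s → s.reg i = 0 → Q s) (m : ℕ) (s : State) (hI : I m s) :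
    Ends (.loop i p) s (m * (T + 1) + 1) Q := by
  induction m using Nat.strong_induction_on generalizing s with
  | _ m ih =>
    by_cases h : s.reg i = 0
    · exact ⟨1, by omega, s, fun k => by simp [step, h], hexit m s hI h⟩
    · obtain ⟨t₁, ht₁, s₁, hs₁, m', hm', hI'⟩ := hbody m s hI h
      obtain ⟨t₂, ht₂, s₂, hs₂, hQ⟩ := ih m' hm' s₁ hI'
      have hle : (m' + 1) * (T + 1) ≤ m * (T + 1) := Nat.mul_le_mul_right _ hm'
      refine ⟨t₂ + t₁ + 1, by linarith, s₂, fun k => ?_, hQ⟩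
      rw [Function.iterate_succ_apply, Function.iterate_add_apply]
      have : step (.loop i p :: k, s) = (p :: .loop i p :: k, s) := by simp [step, h]
      rw [this, hs₁, hs₂]

/-- A list of elementary instructions, executed in order. -/
def block (l : List Instr) : Prog := l.foldr (fun a P => .seq (.instr a) P) .skip

lemma ends_block {l : List Instr} (h : Q (l.foldl (fun s a => a.exec s) s)) :
    Ends (block l) s (2 * l.length + 1) Q := by
  induction l generalizing s with
  | nil => exact ends_skip h
  | cons a l ih =>
    refine Ends.le (T₁ := 1 + (2 * l.length + 1) + 1)
      (Ends.seq (R := fun s' => s' = a.exec s) (ends_instr rfl) ?_)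
      (by simp only [List.length_cons]; omega)
    rintro _ rfl
    exact ih h

lemma Ends.haltsWithin (h : Ends p s T Q) : ∃ s', HaltsWithin p s T s' ∧ Q s' := by
  obtain ⟨t, ht, s', hs, hQ⟩ := h
  exact ⟨s', ⟨t, ht, hs []⟩, hQ⟩

/-- Runs `p` for all pairs `(R[4], R[5])` of numbers in `{1, …, n}`, from `(n, n)` down to
`(1, 1)`; meanwhile `R[6]` is the address of the corresponding entry of the adjacency matrix.
The registers `R[0]`, `R[2]`, `R[3]` have to hold `n`, `1`, `n * n`. -/
def forPairs (p : Prog) : Prog :=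
  .seq (block [.copy 4 0, .copy 6 3])
    (.loop 4 (.seq (block [.copy 5 0])
      (.seq (.loop 5 (.seq (block [.sub 6 6 2]) (.seq p (block [.sub 5 5 2]))))
        (block [.sub 4 4 2]))))

/-- The index `m` of the invariant `J` is the number of pairs not yet treated. -/
lemma ends_forPairs {n : ℕ} {J : ℕ → State → Prop}
    (hJ : ∀ m s s', J m s → s'.mem = s.mem →
      (∀ r, r ≠ 4 → r ≠ 5 → r ≠ 6 → s'.reg r = s.reg r) → J m s')
    (hreg : ∀ m s, J m s → s.reg 0 = n ∧ s.reg 2 = 1 ∧ s.reg 3 = n * n)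
    (hbody : ∀ i < n, ∀ j < n, ∀ s, J (n * i + j + 1) s → s.reg 4 = i + 1 → s.reg 5 = j + 1 →
      s.reg 6 = n * i + j → Ends p s T (fun s' => J (n * i + j) s' ∧ s'.reg 4 = i + 1 ∧
        s'.reg 5 = j + 1 ∧ s'.reg 6 = n * i + j))
    (hs : J (n * n) s) :
    Ends (forPairs p) s (n * (n * (T + 9) + 10) + 7) (J 0) := by
  have inner : ∀ i < n, ∀ m s, (m ≤ n ∧ s.reg 4 = i + 1 ∧ s.reg 5 = m ∧ s.reg 6 = n * i + m ∧
      J (n * i + m) s) →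
      Ends (.loop 5 (.seq (block [.sub 6 6 2]) (.seq p (block [.sub 5 5 2])))) s
        (m * (T + 9) + 1) (fun s => s.reg 4 = i + 1 ∧ s.reg 6 = n * i ∧ J (n * i) s) := by
    intro i hi
    refine ends_loop (T := T + 8) ?_ ?_
    · rintro m s ⟨hm, h4, h5, h6, hJs⟩ h0
      obtain ⟨j, rfl⟩ : ∃ j, m = j + 1 := ⟨m - 1, by omega⟩
      obtain ⟨e0, e2, e3⟩ := hreg _ _ hJs
      refine ((ends_block (l := [.sub 6 6 2]) (Q := fun s' => J (n * i + j + 1) s' ∧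
        s'.reg 4 = i + 1 ∧ s'.reg 5 = j + 1 ∧ s'.reg 6 = n * i + j) ?_).seq fun s' hs' =>
        (hbody i hi j (by omega) s' hs'.1 hs'.2.1 hs'.2.2.1 hs'.2.2.2).seq fun s'' hs'' =>
        ends_block (Q := fun s' => ∃ m' < j + 1, (m' ≤ n ∧ s'.reg 4 = i + 1 ∧ s'.reg 5 = m' ∧
          s'.reg 6 = n * i + m' ∧ J (n * i + m') s')) ?_).le
        (by simp only [List.length_cons, List.length_nil]; omega)
      · refine ⟨hJ _ s _ hJs rfl ?_, ?_⟩
        · intro r h4 h5 h6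
          simp [Instr.exec, h6]
        · simp [Instr.exec, h4, h5, h6, e2, ← add_assoc]
      · obtain ⟨hJ', h4, h5, h6⟩ := hs''
        obtain ⟨e0, e2, e3⟩ := hreg _ _ hJ'
        refine ⟨j, by omega, by omega, ?_⟩
        refine ⟨?_, ?_, ?_, hJ _ s'' _ hJ' rfl ?_⟩
        · simp [Instr.exec, h4]
        · simp [Instr.exec, h5, e2]
        · simp [Instr.exec, h6]
        · intro r h4 h5 h6
          simp [Instr.exec, h5]
    · rintro m s ⟨hm, h4, h5, h6, hJs⟩ h0
      obtain rfl : m = 0 := by omega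
      exact ⟨h4, h6, hJs⟩
  have outer : ∀ m s, (m ≤ n ∧ s.reg 4 = m ∧ s.reg 6 = n * m ∧ J (n * m) s) →
      Ends (.loop 4 (.seq (block [.copy 5 0])
      (.seq (.loop 5 (.seq (block [.sub 6 6 2]) (.seq p (block [.sub 5 5 2]))))
        (block [.sub 4 4 2])))) s (m * (n * (T + 9) + 10) + 1) (J 0) := by
    refine ends_loop (T := n * (T + 9) + 9) ?_ ?_
    · rintro m s ⟨hm, h4, h6, hJs⟩ h0
      obtain ⟨i, rfl⟩ : ∃ i, m = i + 1 := ⟨m - 1, by omega⟩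
      obtain ⟨e0, e2, e3⟩ := hreg _ _ hJs
      refine ((ends_block (l := [.copy 5 0]) (Q := fun s' => (n ≤ n ∧
        s'.reg 4 = i + 1 ∧ s'.reg 5 = n ∧ s'.reg 6 = n * i + n ∧ J (n * i + n) s')) ?_).seq
        fun s' hs' => (inner i (by omega) n s' hs').seq fun s'' hs'' =>
        ends_block (Q := fun s' => ∃ m' < i + 1, (m' ≤ n ∧ s'.reg 4 = m' ∧
          s'.reg 6 = n * m' ∧ J (n * m') s')) ?_).le
        (by simp only [List.length_cons, List.length_nil]; omega)
      · refine ⟨le_rfl, ?_, ?_, ?_, hJ _ s _ hJs rfl ?_⟩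
        · simp [Instr.exec, h4]
        · simp [Instr.exec, e0]
        · simp [Instr.exec, h6, mul_add]
        · intro r h4 h5 h6
          simp [Instr.exec, h5]
      · obtain ⟨h4, h6, hJ'⟩ := hs''
        obtain ⟨e0, e2, e3⟩ := hreg _ _ hJ'
        refine ⟨i, by omega, by omega, ?_, ?_, hJ _ s'' _ hJ' rfl ?_⟩
        · simp [Instr.exec, h4, e2]
        · simp [Instr.exec, h6]
        · intro r h4 h5 h6
          simp [Instr.exec, h4]
    · rintro m s ⟨hm, h4, h6, hJs⟩ h0
      obtain rfl : m = 0 := by omega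
      exact hJs
  obtain ⟨e0, e2, e3⟩ := hreg _ _ hs
  refine ((ends_block (l := [.copy 4 0, .copy 6 3]) (Q := fun s' => n ≤ n ∧ s'.reg 4 = n ∧
    s'.reg 6 = n * n ∧ J (n * n) s') ?_).seq fun s' hs' => outer n s' hs').le
    (by simp only [List.length_cons, List.length_nil]; omega)
  refine ⟨le_rfl, ?_, ?_, hJ _ s _ hs rfl ?_⟩
  · simp [Instr.exec, e0]
  · simp [Instr.exec, e3]
  · intro r h4 h5 h6
    simp [Instr.exec, h4, h6]

end RAM

/-! ### Rooted forests given by parent functions -/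

/-- Adjacency in `Γ`, with the vertices renumbered `1, …, n`. -/
def SimpleGraph.adjNat {n : ℕ} (Γ : SimpleGraph (Fin n)) (u v : ℕ) : Prop :=
  ∃ i j : Fin n, Γ.Adj i j ∧ (i : ℕ) + 1 = u ∧ (j : ℕ) + 1 = v

/-- `par` is the parent function of a rooted forest in `Γ`. The vertices are numbered `1, …, n`,
and `0` is a virtual root: the parent of the roots of the forest, and of itself. -/
structure IsParent {n : ℕ} (Γ : SimpleGraph (Fin n)) (par : ℕ → ℕ) : Prop where
  adj : ∀ v, par v ≠ 0 → Γ.adjNat v (par v)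
  acyclic : ∀ v, ∃ k, par^[k] v = 0

/-- The number of steps from `v` to the virtual root `0`. -/
noncomputable def depth (par : ℕ → ℕ) (v : ℕ) : ℕ := sInf {k | par^[k] v = 0}

/-- Every edge of `Γ` joins a vertex to one of its ancestors. -/
def IsNormal {n : ℕ} (Γ : SimpleGraph (Fin n)) (par : ℕ → ℕ) : Prop :=
  ∀ u v, Γ.adjNat u v → depth par v ≤ depth par u → ∃ k, par^[k] u = v

namespace IsParent

variable {n : ℕ} {Γ : SimpleGraph (Fin n)} {par : ℕ → ℕ}

lemma adjNat_pos {u v : ℕ} (h : Γ.adjNat u v) : 0 < u ∧ u ≤ n ∧ 0 < v ∧ v ≤ n := by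
  obtain ⟨i, j, -, rfl, rfl⟩ := h
  omega

lemma adjNat_symm {u v : ℕ} (h : Γ.adjNat u v) : Γ.adjNat v u := by
  obtain ⟨i, j, h, rfl, rfl⟩ := h
  exact ⟨j, i, h.symm, rfl, rfl⟩

lemma of_zero : IsParent Γ fun _ => 0 :=
  ⟨fun _ h => absurd rfl h, fun _ => ⟨1, rfl⟩⟩

lemma par_zero (h : IsParent Γ par) : par 0 = 0 := by
  by_contra h0
  exact absurd (adjNat_pos (h.adj 0 h0)).1 (lt_irrefl 0)

lemma par_le (h : IsParent Γ par) (v : ℕ) : par v ≤ n := by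
  by_cases h0 : par v = 0
  · omega
  · exact (adjNat_pos (h.adj v h0)).2.2.2

lemma iterate_le (h : IsParent Γ par) {v : ℕ} (hv : v ≤ n) (k : ℕ) : par^[k] v ≤ n := by
  cases k with
  | zero => exact hv
  | succ k => rw [Function.iterate_succ_apply']; exact h.par_le _

lemma iterate_zero (h : IsParent Γ par) (k : ℕ) : par^[k] 0 = 0 :=
  Function.iterate_fixed h.par_zero k

lemma iterate_depth (h : IsParent Γ par) (v : ℕ) : par^[depth par v] v = 0 :=
  Nat.sInf_mem (s := {k | par^[k] v = 0}) (h.acyclic v)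

lemma iterate_eq_zero (h : IsParent Γ par) {v k : ℕ} : par^[k] v = 0 ↔ depth par v ≤ k := by
  refine ⟨fun hk => Nat.sInf_le hk, fun hk => ?_⟩
  obtain ⟨j, rfl⟩ := Nat.exists_eq_add_of_le' hk
  rw [Function.iterate_add_apply, h.iterate_depth, h.iterate_zero]

lemma depth_iterate (h : IsParent Γ par) (v k : ℕ) :
    depth par (par^[k] v) = depth par v - k := by
  apply le_antisymm
  · rw [← h.iterate_eq_zero, ← Function.iterate_add_apply, h.iterate_eq_zero]
    omega
  · rw [Nat.sub_le_iff_le_add, ← h.iterate_eq_zero, Function.iterate_add_apply, h.iterate_depth]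

lemma depth_zero (h : IsParent Γ par) : depth par 0 = 0 := by
  rw [← Nat.le_zero, ← h.iterate_eq_zero]; rfl

lemma depth_pos (h : IsParent Γ par) {v : ℕ} (hv : v ≠ 0) : 0 < depth par v := by
  by_contra h0
  exact hv (h.iterate_eq_zero.2 (Nat.le_of_not_lt h0 : depth par v ≤ 0))

lemma depth_eq (h : IsParent Γ par) {v : ℕ} (hv : v ≠ 0) :
    depth par v = depth par (par v) + 1 := by
  have := h.depth_iterate v 1
  have := h.depth_pos hv
  simp_all
  omega

lemma iterate_inj (h : IsParent Γ par) {v i j : ℕ} (h0 : par^[i] v ≠ 0)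
    (hij : par^[i] v = par^[j] v) : i = j := by
  have hi := h.depth_iterate v i
  have hj := h.depth_iterate v j
  have := h.depth_pos h0
  rw [← hij] at hj
  omega

lemma depth_le (h : IsParent Γ par) {v : ℕ} (hv : v ≤ n) : depth par v ≤ n := by
  have := Finset.card_le_card_of_injOn (s := Finset.range (depth par v)) (t := Finset.Icc 1 n)
    (fun i => par^[i] v) ?_ ?_
  · simpa using this
  · intro i hi
    simp only [Finset.coe_range, Set.mem_Iio] at hi
    have := h.iterate_le hv i
    have : par^[i] v ≠ 0 := fun h0 => absurd (h.iterate_eq_zero.1 h0) (by omega)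
    simp only [Finset.coe_Icc, Set.mem_Icc]
    omega
  · intro i hi j _ hij
    simp only [Finset.coe_range, Set.mem_Iio] at hi
    exact h.iterate_inj (fun h0 => absurd (h.iterate_eq_zero.1 h0) (by omega)) hij

/-- The sum of all depths, which grows whenever the forest is changed. -/
noncomputable def _root_.totalDepth (n : ℕ) (par : ℕ → ℕ) : ℕ :=
  ∑ v ∈ Finset.range (n + 1), depth par v

lemma totalDepth_le (h : IsParent Γ par) : totalDepth n par ≤ (n + 1) * n := by
  refine (Finset.sum_le_card_nsmul _ _ n fun v hv => h.depth_le ?_).trans (by simp)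
  simp at hv
  omega

section Update

variable {u v : ℕ} (h : IsParent Γ par) (huv : Γ.adjNat u v)
  (hk : ∀ k, par^[k] u ≠ v)

include hk in
lemma iterate_update (k : ℕ) : (Function.update par v u)^[k] u = par^[k] u := by
  induction k with
  | zero => rfl
  | succ k ih =>
    rw [Function.iterate_succ_apply', ih, Function.iterate_succ_apply',
      Function.update_of_ne (hk k)]

include h huv hk in
/-- Hanging `v`, with the subtree below it, under a neighbour `u` outside that subtree gives a
forest again. -/
lemma update : IsParent Γ (Function.update par v u) := by
  refine ⟨fun w hw => ?_, fun w => ?_⟩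
  · by_cases hwv : w = v
    · subst hwv
      simpa using adjNat_symm huv
    · rw [Function.update_of_ne hwv] at hw ⊢
      exact h.adj w hw
  · induction hd : depth par w using Nat.strong_induction_on generalizing w with
    | _ d ih =>
      by_cases hw0 : w = 0
      · exact ⟨0, hw0⟩
      by_cases hwv : w = v
      · subst hwv
        obtain ⟨k, hk0⟩ := h.acyclic u
        refine ⟨k + 1, ?_⟩
        rw [Function.iterate_succ_apply, Function.update_self, iterate_update hk, hk0]
      · obtain ⟨k, hk0⟩ := ih _ (by rw [← hd, h.depth_eq hw0]; omega) (par w) rfl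
        refine ⟨k + 1, ?_⟩
        rw [Function.iterate_succ_apply, Function.update_of_ne hwv, hk0]

include h huv hk in
lemma depth_update_self : depth (Function.update par v u) v = depth par u + 1 := by
  rw [(h.update huv hk).depth_eq (adjNat_pos huv).2.2.1.ne', Function.update_self]
  simp only [depth, iterate_update hk]

include h huv hk in
lemma depth_le_update (hd : depth par v ≤ depth par u) (w : ℕ) :
    depth par w ≤ depth (Function.update par v u) w := by
  induction hw : depth par w using Nat.strong_induction_on generalizing w with
  | _ d ih =>
    by_cases hw0 : w = 0
    · rw [← hw, hw0, h.depth_zero]; omega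
    by_cases hwv : w = v
    · rw [hwv, h.depth_update_self huv hk, ← hw, hwv]; omega
    · have := ih _ (by rw [← hw, h.depth_eq hw0]; omega) (par w) rfl
      rw [← hw, h.depth_eq hw0, (h.update huv hk).depth_eq hw0, Function.update_of_ne hwv]
      omega

include h huv hk in
lemma totalDepth_lt_update (hd : depth par v ≤ depth par u) :
    totalDepth n par < totalDepth n (Function.update par v u) := by
  refine Finset.sum_lt_sum (fun w _ => h.depth_le_update huv hk hd w) ⟨v, ?_, ?_⟩
  · have := adjNat_pos huv
    simp
    omega
  · rw [h.depth_update_self huv hk]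
    omega

end Update

/-! ### A balanced separator in a graph with a normal forest -/

/-- Let all edges join vertices at most `L - 1` levels apart. If `x` is a deepest vertex with at
least half of all vertices below it, then removing `x` and its nearest `L - 1` ancestors leaves
only the subtrees below the children of `x` and the rest of the forest as possible components. -/
lemma exists_separator (h : IsParent Γ par) (hN : IsNormal Γ par) {L : ℕ} (hL : 0 < L)
    (hspan : ∀ u k, Γ.adjNat u (par^[k] u) → k < L) :
    ∃ (S : Finset (Fin n)) (col : Fin n → ℕ), S.card ≤ L ∧
      (∀ u v, Γ.Adj u v → u ∉ S → v ∉ S → col u = col v) ∧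
      ∀ v, v ∉ S → 2 * (Finset.univ.filter fun j => j ∉ S ∧ col j = col v).card ≤ n := by
  classical
  let B : ℕ → Finset (Fin n) := fun x => Finset.univ.filter fun v => ∃ k, par^[k] (v + 1) = x
  have hB0 : B 0 = Finset.univ := by
    simp only [B, Finset.filter_eq_self]
    exact fun v _ => h.acyclic _
  obtain ⟨x, hx, hmax⟩ := Finset.exists_max_image
    ((Finset.range (n + 1)).filter fun x => n ≤ 2 * (B x).card) (depth par)
    ⟨0, by simp [hB0]; omega⟩
  simp only [Finset.mem_filter, Finset.mem_range] at hx hmax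
  let S : Finset (Fin n) :=
    Finset.univ.filter fun v => ∃ i < L, par^[i] x = v + 1
  let col : Fin n → ℕ := fun v =>
    if v ∈ B x then par^[depth par (v + 1) - depth par x - 1] (v + 1) else 0
  have memB : ∀ v y, v ∈ B y ↔ ∃ k, par^[k] ((v : ℕ) + 1) = y := fun v y => by simp [B]
  have memS : ∀ v, v ∈ S ↔ ∃ i < L, par^[i] x = (v : ℕ) + 1 := fun v => by simp [S]
  -- a vertex properly below `x` is deeper than `x`
  have hdeep : ∀ v, v ∈ B x → v ∉ S → depth par x < depth par (v + 1) := by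
    intro v hv hvS
    obtain ⟨k, hk⟩ := (memB v x).1 hv
    have hk0 : k ≠ 0 := by
      rintro rfl
      exact hvS ((memS v).2 ⟨0, hL, hk.symm⟩)
    have := h.depth_iterate (v + 1) k
    have := h.depth_pos (Nat.succ_ne_zero (v : ℕ))
    rw [hk] at *
    simp only [Nat.succ_eq_add_one] at *
    omega
  have hcol : ∀ v, v ∈ B x → v ∉ S → depth par (col v) = depth par x + 1 := by
    intro v hv hvS
    have := hdeep v hv hvS
    simp only [col, if_pos hv, h.depth_iterate]
    omega
  -- the case of an edge between `u` and its ancestor `v`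
  have key : ∀ u v : Fin n, Γ.Adj u v → u ∉ S → v ∉ S →
      depth par ((v : ℕ) + 1) ≤ depth par ((u : ℕ) + 1) → col u = col v := by
    intro u v huv hu hv hd
    have hadj : Γ.adjNat (u + 1) (v + 1) := ⟨u, v, huv, rfl, rfl⟩
    obtain ⟨k, hk⟩ := hN _ _ hadj hd
    have hkL : k < L := hspan (u + 1) k (by rw [hk]; exact hadj)
    by_cases hvB : v ∈ B x
    · obtain ⟨j, hj⟩ := (memB v x).1 hvB
      have huB : u ∈ B x := (memB u x).2 ⟨j + k, by rw [Function.iterate_add_apply, hk, hj]⟩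
      have hdv := hdeep v hvB hv
      have := h.depth_iterate (u + 1) k
      rw [hk] at this
      simp only [col, if_pos hvB, if_pos huB]
      rw [← hk, ← Function.iterate_add_apply, hk]
      congr 1
      omega
    · have huB : u ∉ B x := by
        intro huB
        obtain ⟨j, hj⟩ := (memB u x).1 huB
        rcases le_or_gt k j with hkj | hkj
        · obtain ⟨i, rfl⟩ := Nat.exists_eq_add_of_le' hkj
          rw [Function.iterate_add_apply, hk] at hj
          exact hvB ((memB v x).2 ⟨i, hj⟩)
        · refine hv ((memS v).2 ⟨k - j, by omega, ?_⟩)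
          rw [← hj, ← Function.iterate_add_apply, ← hk]
          congr 1
          omega
      simp only [col, if_neg hvB, if_neg huB]
  refine ⟨S, col, ?_, fun u v huv hu hv => ?_, fun v hv => ?_⟩
  · have := Finset.card_le_card_of_surjOn (s := Finset.range L) (t := S.image (↑))
      (fun i => par^[i] x - 1) ?_
    · simpa [Finset.card_image_of_injective _ Fin.val_injective] using this
    · intro y hy
      simp only [Finset.coe_image, Set.mem_image, Finset.mem_coe] at hy
      obtain ⟨v, hv, rfl⟩ := hy
      obtain ⟨i, hi, hiv⟩ := (memS v).1 hv
      exact ⟨i, by simpa using hi, by simp [hiv]⟩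
  · rcases le_total (depth par ((v : ℕ) + 1)) (depth par ((u : ℕ) + 1)) with hd | hd
    · exact key u v huv hu hv hd
    · exact (key v u huv.symm hv hu hd).symm
  · by_cases hvB : v ∈ B x
    · have hc := hcol v hvB hv
      have hsub : (Finset.univ.filter fun j => j ∉ S ∧ col j = col v) ⊆ B (col v) := by
        intro j hj
        simp only [Finset.mem_filter, Finset.mem_univ, true_and] at hj
        have hjB : j ∈ B x := by
          by_contra hjB
          have : col j = 0 := if_neg hjB
          rw [← hj.2, this, h.depth_zero] at hc
          omega
        rw [memB, ← hj.2]
        exact ⟨_, (if_pos hjB).symm⟩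
      have hle := Finset.card_le_card hsub
      by_contra hlt
      have hcn : col v < n + 1 := by
        rw [Nat.lt_succ_iff]
        simp only [col, if_pos hvB]
        exact h.iterate_le v.2 _
      have := hmax (col v) ⟨hcn, by omega⟩
      omega
    · have hsub : (Finset.univ.filter fun j => j ∉ S ∧ col j = col v) ⊆ (B x)ᶜ := by
        intro j hj
        simp only [Finset.mem_filter, Finset.mem_univ, true_and] at hj
        rw [Finset.mem_compl]
        intro hjB
        have hc := hcol j hjB hj.1
        have : col v = 0 := if_neg hvB
        rw [hj.2, this, h.depth_zero] at hc
        omega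
      have hle := Finset.card_le_card hsub
      have := Finset.card_compl (B x)
      rw [Fintype.card_fin] at this
      omega

/-- A deepest vertex has only ancestors as neighbours, one of which is not its parent. -/
lemma _root_.IsNormal.exists_long_back_edge (hN : IsNormal Γ par) [DecidableRel Γ.Adj]
    {D : ℕ} (hD : 2 ≤ D) (hn : 0 < n) (hreg : Γ.IsRegularOfDegree D) :
    ∃ u k, 2 ≤ k ∧ Γ.adjNat u (par^[k] u) := by
  have : Nonempty (Fin n) := ⟨⟨0, hn⟩⟩
  obtain ⟨u, -, hu⟩ := Finset.exists_max_image (Finset.univ : Finset (Fin n))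
    (fun v => depth par ((v : ℕ) + 1)) Finset.univ_nonempty
  have hcard : 1 < (Γ.neighborFinset u).card := by
    rw [SimpleGraph.card_neighborFinset_eq_degree, hreg u]; omega
  obtain ⟨a, ha, b, hb, hab⟩ := Finset.one_lt_card.1 hcard
  rw [SimpleGraph.mem_neighborFinset] at ha hb
  obtain ⟨k, hk⟩ := hN (u + 1) (a + 1) ⟨u, a, ha, rfl, rfl⟩ (hu a (Finset.mem_univ _))
  obtain ⟨l, hl⟩ := hN (u + 1) (b + 1) ⟨u, b, hb, rfl, rfl⟩ (hu b (Finset.mem_univ _))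
  have hk0 : k ≠ 0 := by
    rintro rfl
    exact ha.ne (Fin.ext (by simpa using hk))
  have hl0 : l ≠ 0 := by
    rintro rfl
    exact hb.ne (Fin.ext (by simpa using hl))
  have hkl : k ≠ l := by
    rintro rfl
    exact hab (Fin.ext (by simpa using hk.symm.trans hl))
  rcases le_or_gt 2 k with h2 | h2
  · exact ⟨u + 1, k, h2, u, a, ha, rfl, hk.symm⟩
  · exact ⟨u + 1, l, by omega, u, b, hb, rfl, hl.symm⟩

end IsParent

/-! ### Random walks and separators -/

section Walk

variable {n : ℕ} (Γ : SimpleGraph (Fin n)) [DecidableRel Γ.Adj] {D : ℕ}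

lemma walkMatrix_apply (hreg : Γ.IsRegularOfDegree D) (i j : Fin n) :
    walkMatrix Γ i j = if Γ.Adj i j then 1 / (D : ℝ) else 0 := by
  simp [walkMatrix, hreg i]

lemma walkMatrix_mem_doublyStochastic (hD : 0 < D) (hreg : Γ.IsRegularOfDegree D) :
    walkMatrix Γ ∈ doublyStochastic ℝ (Fin n) := by
  have hrow : ∀ i, ∑ j, walkMatrix Γ i j = 1 := by
    intro i
    simp only [walkMatrix_apply Γ hreg]
    rw [← Finset.sum_filter, Finset.sum_const, ← SimpleGraph.neighborFinset_eq_filter,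
      SimpleGraph.card_neighborFinset_eq_degree, hreg i]
    have : (D : ℝ) ≠ 0 := by positivity
    simp [this]
  rw [mem_doublyStochastic_iff_sum]
  refine ⟨fun i j => ?_, hrow, fun j => ?_⟩
  · rw [walkMatrix_apply Γ hreg]
    split_ifs <;> positivity
  · rw [← hrow j]
    refine Finset.sum_congr rfl fun i _ => ?_
    simp only [walkMatrix_apply Γ hreg, Γ.adj_comm]

/-- Expected number of visits to `S` at the times `0, …, t` of the walk from `v`. -/
noncomputable def expectedVisits (S : Finset (Fin n)) (t : ℕ) (v : Fin n) : ℝ :=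
  ∑ k ∈ Finset.range (t + 1), ∑ s ∈ S, walkDist Γ v k s

variable {Γ}

lemma walkDist_mem_doublyStochastic (hD : 0 < D) (hreg : Γ.IsRegularOfDegree D) (t : ℕ) :
    walkMatrix Γ ^ t ∈ doublyStochastic ℝ (Fin n) :=
  pow_mem (walkMatrix_mem_doublyStochastic Γ hD hreg) t

lemma walkDist_nonneg (hD : 0 < D) (hreg : Γ.IsRegularOfDegree D) (v : Fin n) (t : ℕ)
    (j : Fin n) : 0 ≤ walkDist Γ v t j :=
  (mem_doublyStochastic_iff_sum.1 (walkDist_mem_doublyStochastic hD hreg t)).1 v j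

lemma sum_walkDist (hD : 0 < D) (hreg : Γ.IsRegularOfDegree D) (v : Fin n) (t : ℕ) :
    ∑ j, walkDist Γ v t j = 1 :=
  (mem_doublyStochastic_iff_sum.1 (walkDist_mem_doublyStochastic hD hreg t)).2.1 v

lemma sum_walkDist_start (hD : 0 < D) (hreg : Γ.IsRegularOfDegree D) (j : Fin n) (t : ℕ) :
    ∑ v, walkDist Γ v t j = 1 :=
  (mem_doublyStochastic_iff_sum.1 (walkDist_mem_doublyStochastic hD hreg t)).2.2 j

lemma walkDist_zero (v j : Fin n) : walkDist Γ v 0 j = if v = j then 1 else 0 := by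
  simp [walkDist, Matrix.one_apply]

lemma walkDist_succ (v j : Fin n) (t : ℕ) :
    walkDist Γ v (t + 1) j = ∑ u, walkMatrix Γ v u * walkDist Γ u t j := by
  simp only [walkDist, pow_succ', Matrix.mul_apply]

lemma sum_expectedVisits (hD : 0 < D) (hreg : Γ.IsRegularOfDegree D) (S : Finset (Fin n))
    (t : ℕ) : ∑ v, expectedVisits Γ S t v = (t + 1) * S.card := by
  simp only [expectedVisits]
  rw [Finset.sum_comm]
  have : ∀ k, ∑ v, ∑ s ∈ S, walkDist Γ v k s = S.card := by
    intro k
    rw [Finset.sum_comm]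
    simp [sum_walkDist_start hD hreg]
  simp [this]

lemma expectedVisits_nonneg (hD : 0 < D) (hreg : Γ.IsRegularOfDegree D) (S : Finset (Fin n))
    (t : ℕ) (v : Fin n) : 0 ≤ expectedVisits Γ S t v :=
  Finset.sum_nonneg fun _ _ => Finset.sum_nonneg fun _ _ => walkDist_nonneg hD hreg _ _ _

lemma one_le_expectedVisits (hD : 0 < D) (hreg : Γ.IsRegularOfDegree D) {S : Finset (Fin n)}
    (t : ℕ) {v : Fin n} (hv : v ∈ S) : 1 ≤ expectedVisits Γ S t v := by
  rw [expectedVisits, Finset.sum_range_succ']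
  have h1 : ∑ s ∈ S, walkDist Γ v 0 s = 1 := by simp [walkDist_zero, hv]
  have h2 : 0 ≤ ∑ k ∈ Finset.range t, ∑ s ∈ S, walkDist Γ v (k + 1) s :=
    Finset.sum_nonneg fun _ _ => Finset.sum_nonneg fun _ _ => walkDist_nonneg hD hreg _ _ _
  linarith

/-- After its first step, the walk makes at most as many visits to `S` as in total. -/
lemma sum_mul_expectedVisits_le (hD : 0 < D) (hreg : Γ.IsRegularOfDegree D)
    (S : Finset (Fin n)) (t : ℕ) (v : Fin n) :
    ∑ u, walkMatrix Γ v u * expectedVisits Γ S t u ≤ expectedVisits Γ S (t + 1) v := by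
  have h1 : ∑ u, walkMatrix Γ v u * expectedVisits Γ S t u
      = ∑ k ∈ Finset.range (t + 1), ∑ s ∈ S, walkDist Γ v (k + 1) s := by
    simp only [expectedVisits, Finset.mul_sum, walkDist_succ]
    rw [Finset.sum_comm]
    refine Finset.sum_congr rfl fun k _ => Finset.sum_comm
  have h2 : 0 ≤ ∑ s ∈ S, walkDist Γ v 0 s :=
    Finset.sum_nonneg fun _ _ => walkDist_nonneg hD hreg _ _ _
  rw [h1, expectedVisits, Finset.sum_range_succ' _ (t + 1)]
  linarith

/-- To leave the part of `v`, the walk has to visit the separator `S`. -/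
lemma escape_le_expectedVisits (hD : 0 < D) (hreg : Γ.IsRegularOfDegree D)
    {S : Finset (Fin n)} {col : Fin n → ℕ}
    (hcol : ∀ u v, Γ.Adj u v → u ∉ S → v ∉ S → col u = col v) (t : ℕ) (v : Fin n)
    (hv : v ∉ S) :
    ∑ j with ¬ (j ∉ S ∧ col j = col v), walkDist Γ v t j ≤ expectedVisits Γ S t v := by
  induction t generalizing v with
  | zero =>
    refine le_trans (le_of_eq (Finset.sum_eq_zero fun j hj => ?_))
      (expectedVisits_nonneg hD hreg S 0 v)
    rw [walkDist_zero, if_neg]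
    rintro rfl
    simp [hv] at hj
  | succ t ih =>
    refine le_trans ?_ (sum_mul_expectedVisits_le hD hreg S t v)
    simp only [walkDist_succ]
    rw [Finset.sum_comm]
    refine Finset.sum_le_sum fun u _ => ?_
    rw [← Finset.mul_sum, walkMatrix_apply Γ hreg]
    split_ifs with huv
    · refine mul_le_mul_of_nonneg_left ?_ (by positivity)
      -- from `S` the walk need not return to `S`, but its visit at time `0` already counts
      by_cases hu : u ∈ S
      · refine le_trans ?_ (one_le_expectedVisits hD hreg t hu)
        rw [← sum_walkDist hD hreg u t]
        exact Finset.sum_le_sum_of_subset_of_nonneg (Finset.subset_univ _)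
          fun _ _ _ => walkDist_nonneg hD hreg _ _ _
      · rw [hcol v u huv hv hu]
        exact ih u hu
    · simp

/-- If removing `S` leaves only parts with at most half of the vertices, then a walk that is
well mixed after `t` steps has to visit `S` with constant probability, while all walks together
make only `(t + 1) * |S|` visits to `S`. -/
lemma card_mixing_le (hn : 0 < n) (hD : 0 < D) (hreg : Γ.IsRegularOfDegree D)
    {S : Finset (Fin n)} {col : Fin n → ℕ}
    (hcol : ∀ u v, Γ.Adj u v → u ∉ S → v ∉ S → col u = col v)
    (hsize : ∀ v, v ∉ S →
      2 * (Finset.univ.filter fun j => j ∉ S ∧ col j = col v).card ≤ n) (t : ℕ) :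
    13 * ({v : Fin n | tvDist (walkDist Γ v t) (unifDist n) < 1 / 30}.ncard : ℝ) ≤
      30 * ((t + 1) * S.card) := by
  have hgood : ∀ v, tvDist (walkDist Γ v t) (unifDist n) < 1 / 30 →
      13 / 30 ≤ expectedVisits Γ S t v := by
    intro v hv
    by_cases hvS : v ∈ S
    · linarith [one_le_expectedVisits hD hreg t hvS]
    refine le_trans ?_ (escape_le_expectedVisits hD hreg hcol t v hvS)
    have hn' : (0 : ℝ) < n := by exact_mod_cast hn
    set J := Finset.univ.filter fun j => ¬ (j ∉ S ∧ col j = col v) with hJ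
    have hJc : (n : ℝ) / 2 ≤ J.card := by
      have h1 : (Finset.univ.filter fun j => j ∉ S ∧ col j = col v).card + J.card = n := by
        rw [hJ, Finset.card_filter_add_card_filter_not, Finset.card_univ, Fintype.card_fin]
      have h2 := hsize v hvS
      have h3 : n ≤ 2 * J.card := by omega
      have h4 : (n : ℝ) ≤ 2 * J.card := by exact_mod_cast h3
      linarith
    -- the crude bound by twice the total variation distance suffices here
    have h1 : ∑ j ∈ J, (unifDist n j - walkDist Γ v t j) ≤
        ∑ j, |walkDist Γ v t j - unifDist n j| := by
      refine (Finset.sum_le_sum fun j _ => ?_).trans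
        (Finset.sum_le_sum_of_subset_of_nonneg (Finset.subset_univ J) fun _ _ _ => abs_nonneg _)
      rw [abs_sub_comm]
      exact le_abs_self _
    have h2 : ∑ j ∈ J, unifDist n j = J.card / n := by
      simp [unifDist, div_eq_mul_inv]
    have h3 : (1 : ℝ) / 2 ≤ J.card / n := by
      rw [le_div_iff₀ hn']
      linarith
    rw [Finset.sum_sub_distrib, h2] at h1
    unfold tvDist at hv
    linarith
  rw [Set.ncard_eq_toFinset_card', Set.toFinset_ofPred]
  have h1 : ((Finset.univ.filter fun v =>
      tvDist (walkDist Γ v t) (unifDist n) < 1 / 30).card : ℝ) * (13 / 30) ≤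
      ∑ v, expectedVisits Γ S t v := by
    rw [← nsmul_eq_mul]
    refine (Finset.card_nsmul_le_sum _ _ _ fun v hv => hgood v ?_).trans
      (Finset.sum_le_sum_of_subset_of_nonneg (Finset.subset_univ _)
        fun _ _ _ => expectedVisits_nonneg hD hreg _ _ _)
    simpa using hv
  rw [sum_expectedVisits hD hreg] at h1
  linarith

/-- On a perfect matching the walk is deterministic, hence never close to uniform. -/
lemma le_tvDist_of_matching (hreg : Γ.IsRegularOfDegree 1) (v : Fin n) (t : ℕ) :
    1 / 30 ≤ tvDist (walkDist Γ v t) (unifDist n) := by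
  obtain ⟨w, hw⟩ : ∃ w, walkDist Γ v t = walkDist Γ w 0 := by
    induction t generalizing v with
    | zero => exact ⟨v, rfl⟩
    | succ t ih =>
      obtain ⟨u, hu⟩ := Finset.card_eq_one.1
        ((SimpleGraph.card_neighborFinset_eq_degree Γ v).trans (hreg v))
      obtain ⟨w, hw⟩ := ih u
      refine ⟨w, funext fun j => ?_⟩
      rw [walkDist_succ, ← hw, Finset.sum_eq_single u]
      · have : Γ.Adj v u := by rw [← SimpleGraph.mem_neighborFinset, hu]; simp
        simp [walkMatrix_apply Γ hreg, this]
      · intro b _ hb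
        have : ¬ Γ.Adj v b := by rw [← SimpleGraph.mem_neighborFinset, hu]; simpa using hb
        simp [walkMatrix_apply Γ hreg, this]
      · simp
  have hn : (2 : ℝ) ≤ n := by
    have := Γ.degree_lt_card_verts v
    rw [hreg v, Fintype.card_fin] at this
    exact_mod_cast this
  have h1 : |walkDist Γ w 0 w - unifDist n w| ≤ ∑ j, |walkDist Γ w 0 j - unifDist n j| :=
    Finset.single_le_sum (f := fun j => |walkDist Γ w 0 j - unifDist n j|)
      (fun _ _ => abs_nonneg _) (Finset.mem_univ w)
  have h2 : (1 : ℝ) / n ≤ 1 / 2 := one_div_le_one_div_of_le (by norm_num) hn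
  have h3 := le_abs_self (walkDist Γ w 0 w - unifDist n w)
  rw [walkDist_zero, if_pos rfl, unifDist] at h3
  rw [hw, tvDist]
  rw [walkDist_zero, if_pos rfl] at h1
  simp only [unifDist] at *
  linarith

end Walk

/-! ### The algorithm -/

/-!
Use of the registers: `R[0] = n`, `R[2] = 1`, `R[3] = n * n`; `R[4]`, `R[5]`, `R[6]` belong to
`forPairs`; `R[7]`, `R[8]`, `R[9]` are the current vertex, the depth and the position in `climb`;
`R[11]` is the flag of `buildForest`; `R[12]`, `R[13]` are the length and the lowest vertex of the
best cycle so far; `R[10]`, `R[14]`, `R[15]`, `R[16]` hold intermediate results.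
-/

namespace RAM

variable {n : ℕ} {Γ : SimpleGraph (Fin n)} {par : ℕ → ℕ} {s : State}

/-- The machine state represents the graph `Γ` and the parent function `par`: the parent of
`v ∈ {0, …, n}` is stored at address `n * n + v`. -/
structure Layout (Γ : SimpleGraph (Fin n)) (par : ℕ → ℕ) (s : State) : Prop where
  reg_zero : s.reg 0 = n
  reg_two : s.reg 2 = 1
  reg_three : s.reg 3 = n * n
  adj : ∀ i < n, ∀ j < n, s.mem (n * i + j) ≠ 0 ↔ Γ.adjNat (i + 1) (j + 1)
  par : ∀ v ≤ n, s.mem (n * n + v) = par v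

lemma Layout.congr {s' : State} (h : Layout Γ par s) (hm : s'.mem = s.mem)
    (h0 : s'.reg 0 = s.reg 0) (h2 : s'.reg 2 = s.reg 2) (h3 : s'.reg 3 = s.reg 3) :
    Layout Γ par s' :=
  ⟨h0 ▸ h.1, h2 ▸ h.2, h3 ▸ h.3, hm ▸ h.4, hm ▸ h.5⟩

/-- `pos` is `k + 1` if `v` is the `k`-th ancestor of `u`, and `0` if `v` is no ancestor
of `u`. -/
def IsPosition (par : ℕ → ℕ) (u v pos : ℕ) : Prop :=
  (pos = 0 ∧ ∀ k, par^[k] u ≠ v) ∨ ∃ k, pos = k + 1 ∧ par^[k] u = v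

/-- Climbs from the vertex `R[7]` to the virtual root. This adds the depth of `R[7]` to `R[8]`,
and if `R[5]` is met on the way, its position is written to `R[9]`. -/
def climb : Prog :=
  .loop 7 (.seq (block [.add 8 8 2, .sub 10 7 5, .sub 16 5 7, .add 10 10 16])
    (.seq (.ite 10 .skip (.instr (.copy 9 8))) (block [.add 10 3 7, .load 7 10])))

lemma ends_climb (h : IsParent Γ par) (hs : Layout Γ par s) {u v : ℕ} (hu : u ≤ n) (hv : v ≠ 0)
    (h5 : s.reg 5 = v) (h7 : s.reg 7 = u) (h8 : s.reg 8 = 0) (h9 : s.reg 9 = 0) :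
    Ends climb s (n * 20 + 1) (fun s' => s'.mem = s.mem ∧
      (∀ r, r ≠ 7 → r ≠ 8 → r ≠ 9 → r ≠ 10 → r ≠ 16 → s'.reg r = s.reg r) ∧
      s'.reg 8 = depth par u ∧ IsPosition par u v (s'.reg 9)) := by
  refine (ends_loop (T := 19) (I := fun m s' => s'.mem = s.mem ∧
    (∀ r, r ≠ 7 → r ≠ 8 → r ≠ 9 → r ≠ 10 → r ≠ 16 → s'.reg r = s.reg r) ∧
    ∃ i, i + m = depth par u ∧ s'.reg 7 = par^[i] u ∧ s'.reg 8 = i ∧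
      ((s'.reg 9 = 0 ∧ ∀ k < i, par^[k] u ≠ v) ∨ ∃ k, s'.reg 9 = k + 1 ∧ par^[k] u = v))
    ?_ ?_ (depth par u) s ⟨rfl, fun _ _ _ _ _ _ => rfl, 0, by omega, h7, h8, ?_⟩).le ?_
  · rintro m s₁ ⟨hmem, hreg, i, him, hs7, hs8, hs9⟩ h0
    have hi0 : par^[i] u ≠ 0 := hs7 ▸ h0
    have hm0 : m ≠ 0 := by
      rintro rfl
      exact hi0 (h.iterate_eq_zero.2 (by omega))
    have hs₁ := hs.congr hmem (hreg 0 (by decide) (by decide) (by decide) (by decide) (by decide))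
      (hreg 2 (by decide) (by decide) (by decide) (by decide) (by decide))
      (hreg 3 (by decide) (by decide) (by decide) (by decide) (by decide))
    have hs5 : s₁.reg 5 = v :=
      (hreg 5 (by decide) (by decide) (by decide) (by decide) (by decide)).trans h5
    refine ((ends_block (Q := fun s' => s'.mem = s.mem ∧
      (∀ r, r ≠ 7 → r ≠ 8 → r ≠ 9 → r ≠ 10 → r ≠ 16 → s'.reg r = s.reg r) ∧
      s'.reg 7 = par^[i] u ∧ s'.reg 8 = i + 1 ∧ s'.reg 9 = s₁.reg 9 ∧
      (s'.reg 10 = 0 ↔ par^[i] u = v)) ?_).seq fun s₂ hs₂ => Ends.seq (R := fun s' =>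
      s'.mem = s.mem ∧
      (∀ r, r ≠ 7 → r ≠ 8 → r ≠ 9 → r ≠ 10 → r ≠ 16 → s'.reg r = s.reg r) ∧
      s'.reg 7 = par^[i] u ∧ s'.reg 8 = i + 1 ∧
      ((s'.reg 9 = 0 ∧ ∀ k < i + 1, par^[k] u ≠ v) ∨ ∃ k, s'.reg 9 = k + 1 ∧ par^[k] u = v))
      (ends_ite (T := 1) (fun h10 => ends_skip ?_) (fun h10 => ends_instr ?_))
      fun s₃ hs₃ => ends_block ?_).le
      (by simp only [List.length_cons, List.length_nil]; omega)
    · refine ⟨hmem, fun r _ _ _ _ _ => ?_, ?_, ?_, ?_, ?_⟩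
      · simp [Instr.exec, *]
      · simp [Instr.exec, hs7]
      · simp [Instr.exec, hs8, hs₁.reg_two]
      · simp [Instr.exec]
      · simp [Instr.exec, hs7, hs5]
        omega
    · obtain ⟨hm2, hr2, h27, h28, h29, h210⟩ := hs₂
      refine ⟨hm2, hr2, h27, h28, ?_⟩
      rw [h29]
      refine hs9.imp_left fun ⟨h90, hlt⟩ => ⟨h90, fun k hk => ?_⟩
      rcases Nat.lt_succ_iff_lt_or_eq.1 hk with hk | rfl
      · exact hlt k hk
      · exact fun hkv => h10 (h210.2 hkv)
    · obtain ⟨hm2, hr2, h27, h28, h29, h210⟩ := hs₂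
      refine ⟨hm2, fun r _ _ _ _ _ => ?_, ?_, ?_, .inr ⟨i, ?_, h210.1 h10⟩⟩
      · simp [Instr.exec, *]
      · simp [Instr.exec, h27]
      · simp [Instr.exec, h28]
      · simp [Instr.exec, h28]
    · obtain ⟨hm3, hr3, h37, h38, h39⟩ := hs₃
      have h33 : s₃.reg 3 = n * n :=
        (hr3 3 (by decide) (by decide) (by decide) (by decide) (by decide)).trans hs.reg_three
      refine ⟨m - 1, by omega, hm3, fun r _ _ _ _ _ => ?_, i + 1, by omega, ?_, ?_, ?_⟩
      · simp [Instr.exec, *]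
      · simp [Instr.exec, h37, h33, hm3, hs.par _ (h.iterate_le hu i),
          Function.iterate_succ_apply']
      · simp [Instr.exec, h38]
      · simpa [Instr.exec] using h39
  · rintro m s₁ ⟨hmem, hreg, i, him, hs7, hs8, hs9⟩ h0
    have hi : depth par u ≤ i := h.iterate_eq_zero.1 (hs7 ▸ h0)
    refine ⟨hmem, hreg, by omega, hs9.imp_left fun ⟨h90, hlt⟩ => ⟨h90, fun k => ?_⟩⟩
    rcases lt_or_ge k i with hk | hk
    · exact hlt k hk
    · rw [h.iterate_eq_zero.2 (hi.trans hk)]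
      exact hv.symm
  · exact .inl ⟨h9, by simp⟩
  · have := Nat.mul_le_mul_right 20 (h.depth_le hu)
    omega

/-- If the current pair `(u, v)` is an edge such that `v` is not deeper than `u` and no ancestor
of `u`, then `u` becomes the parent of `v`, and the flag `R[11]` is set. -/
def improve : Prog :=
  .seq (block [.load 10 6]) (.ite 10
    (.seq (block [.copy 7 4, .const 8 0, .const 9 0])
    (.seq climb
    (.seq (block [.copy 14 8, .copy 15 9, .copy 7 5, .const 8 0, .const 9 0])
    (.seq climb
    (.seq (block [.sub 10 8 14, .add 10 10 15])
      (.ite 10 .skip (block [.add 10 3 5, .store 10 4, .copy 11 2])))))))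
    .skip)

lemma ends_improve (h : IsParent Γ par) (hs : Layout Γ par s) {i j : ℕ} (hi : i < n) (hj : j < n)
    (h4 : s.reg 4 = i + 1) (h5 : s.reg 5 = j + 1) (h6 : s.reg 6 = n * i + j) :
    Ends improve s (n * 40 + 60) (fun s' => ∃ par', IsParent Γ par' ∧ Layout Γ par' s' ∧
      s'.reg 4 = i + 1 ∧ s'.reg 5 = j + 1 ∧ s'.reg 6 = n * i + j ∧
      ((s'.reg 11 = s.reg 11 ∧ par' = par ∧ (Γ.adjNat (i + 1) (j + 1) →
          depth par (j + 1) ≤ depth par (i + 1) → ∃ k, par^[k] (i + 1) = j + 1)) ∨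
        (s'.reg 11 = 1 ∧ totalDepth n par < totalDepth n par'))) := by
  obtain ⟨e0, e2, e3, eadj, epar⟩ := id hs
  have hij := eadj i hi j hj
  refine ((ends_block (Q := fun s' => s'.mem = s.mem ∧ (∀ r, r ≠ 10 → s'.reg r = s.reg r) ∧
    (s'.reg 10 ≠ 0 ↔ Γ.adjNat (i + 1) (j + 1))) ?_).seq fun s₁ ⟨hm1, hr1, h10⟩ =>
    ends_ite (T := n * 40 + 50) (fun hadj => ?_) fun hadj => Ends.le (ends_skip
      ⟨par, h, ?_, ?_, ?_, ?_, .inl ⟨?_, rfl, ?_⟩⟩) (by omega)).le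
      (by simp only [List.length_cons, List.length_nil]; omega)
  · refine ⟨rfl, fun r hr => ?_, ?_⟩
    · simp [Instr.exec, hr]
    · simpa [Instr.exec, h6] using hij
  · have hadj' := h10.1 hadj
    refine ((ends_block (Q := fun s' => s'.mem = s.mem ∧
      (∀ r, r ≠ 7 → r ≠ 8 → r ≠ 9 → r ≠ 10 → r ≠ 16 → s'.reg r = s.reg r) ∧
      s'.reg 7 = i + 1 ∧ s'.reg 8 = 0 ∧ s'.reg 9 = 0) ?_).seq fun s₂ ⟨hm2, hr2, h27, h28, h29⟩ =>
      (ends_climb (s := s₂) (u := i + 1) (v := j + 1) h ?_ (by omega) (by omega) ?_ h27 h28 h29).seq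
      fun s₃ ⟨hm3, hr3, h38, h39⟩ =>
      (ends_block (Q := fun s' => s'.mem = s.mem ∧
      (∀ r, r ≠ 7 → r ≠ 8 → r ≠ 9 → r ≠ 10 → r ≠ 14 → r ≠ 15 → r ≠ 16 → s'.reg r = s.reg r) ∧
      s'.reg 7 = j + 1 ∧ s'.reg 8 = 0 ∧ s'.reg 9 = 0 ∧ s'.reg 14 = depth par (i + 1) ∧
      IsPosition par (i + 1) (j + 1) (s'.reg 15)) ?_).seq
      fun s₄ ⟨hm4, hr4, h47, h48, h49, h414, h415⟩ =>
      (ends_climb (s := s₄) (u := j + 1) (v := j + 1) h ?_ (by omega) (by omega) ?_ h47 h48 h49).seq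
      fun s₅ ⟨hm5, hr5, h58, h59⟩ =>
      (ends_block (Q := fun s' => s'.mem = s.mem ∧
      (∀ r, r ≠ 7 → r ≠ 8 → r ≠ 9 → r ≠ 10 → r ≠ 14 → r ≠ 15 → r ≠ 16 → s'.reg r = s.reg r) ∧
      s'.reg 10 = depth par (j + 1) - depth par (i + 1) + s₄.reg 15) ?_).seq
      fun s₆ ⟨hm6, hr6, h610⟩ => ends_ite (T := 7)
        (fun h0 => Ends.le (ends_skip ?_) (by omega))
        fun h0 => ends_block ?_).le
      (by simp only [List.length_cons, List.length_nil]; omega)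
    · refine ⟨hm1, fun r _ _ _ _ _ => ?_, ?_, ?_, ?_⟩
      · simp [Instr.exec, *]
      · simp [Instr.exec, hr1, h4]
      · simp [Instr.exec]
      · simp [Instr.exec]
    · exact hs.congr hm2 (by simp [hr2]) (by simp [hr2]) (by simp [hr2])
    · simp [hr2, h5]
    · refine ⟨hm3.trans hm2, fun r _ _ _ _ _ _ _ => ?_, ?_, ?_, ?_, ?_, ?_⟩
      · simp [Instr.exec, *]
      · simp [Instr.exec, hr3, hr2, h5]
      · simp [Instr.exec]
      · simp [Instr.exec]
      · simp [Instr.exec, h38]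
      · simpa [Instr.exec] using h39
    · exact hs.congr hm4 (by simp [hr4]) (by simp [hr4]) (by simp [hr4])
    · simp [hr4, h5]
    · refine ⟨hm5.trans hm4, fun r _ _ _ _ _ _ _ => ?_, ?_⟩
      · simp [Instr.exec, *]
      · simp [Instr.exec, h58, hr5, h414]
    · refine ⟨par, h, hs.congr hm6 (by simp [hr6]) (by simp [hr6]) (by simp [hr6]), by simp [hr6, h4],
        by simp [hr6, h5], by simp [hr6, h6], .inl ⟨by simp [hr6], rfl, fun _ hd => ?_⟩⟩
      rcases h415 with ⟨hpos, -⟩ | ⟨k, -, hk⟩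
      · omega
      · exact ⟨k, hk⟩
    -- `R[10] = 0` says both that `v` is not deeper than `u` and that `v` is no ancestor of `u`
    · have hno : ∀ k, par^[k] (i + 1) ≠ j + 1 := by
        rcases h415 with ⟨-, hno⟩ | ⟨k, hk, -⟩
        · exact hno
        · omega
      refine ⟨Function.update par (j + 1) (i + 1), h.update hadj' hno, ⟨?_, ?_, ?_, ?_, ?_⟩, ?_, ?_, ?_,
        .inr ⟨?_, h.totalDepth_lt_update hadj' hno (by omega)⟩⟩
      · simp [Instr.exec, hr6, e0]
      · simp [Instr.exec, hr6, e2]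
      · simp [Instr.exec, hr6, e3]
      · intro i' hi' j' hj'
        have : n * i' + j' < n * n := by nlinarith
        have hne : n * i' + j' ≠ n * n + (j + 1) := by omega
        simpa [Instr.exec, hr6, e3, h5, hm6, hne] using eadj i' hi' j' hj'
      · intro w hw
        by_cases hwj : w = j + 1
        · subst hwj
          simp [Instr.exec, hr6, e3, h5, h4]
        · simp [Instr.exec, hr6, e3, h5, h4, hwj, hm6, epar w hw]
      · simp [Instr.exec, hr6, h4]
      · simp [Instr.exec, hr6, h5]
      · simp [Instr.exec, hr6, h6]
      · simp [Instr.exec, hr6, e2]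
  · exact hs.congr hm1 (by simp [hr1]) (by simp [hr1]) (by simp [hr1])
  · simp [hr1, h4]
  · simp [hr1, h5]
  · simp [hr1, h6]
  · simp [hr1]
  · intro hadj'
    exact absurd hadj (h10.2 hadj')

lemma index_inj {i j i' j' : ℕ} (hj : j < n) (hj' : j' < n) (h : n * i + j = n * i' + j') :
    i = i' ∧ j = j' := by
  have h1 : i = i' := by
    have e1 := Nat.mul_add_div (by omega : n > 0) i j
    have e2 := Nat.mul_add_div (by omega : n > 0) i' j'
    rw [Nat.div_eq_of_lt hj] at e1
    rw [Nat.div_eq_of_lt hj'] at e2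
    rw [h] at e1
    omega
  subst h1
  exact ⟨rfl, by omega⟩

/-- Repeats rounds of improvements until a round changes nothing, which leaves `R[11] = 0`. -/
def buildForest : Prog :=
  .loop 11 (.seq (block [.const 11 0]) (forPairs improve))

/-- A round of improvements either finds nothing to improve, and then the forest is normal, or it
increases the total depth. -/
lemma ends_improve_forPairs (h : IsParent Γ par) (hs : Layout Γ par s) (h11 : s.reg 11 = 0) :
    Ends (forPairs improve) s (n * (n * (n * 40 + 60 + 9) + 10) + 7) (fun s' =>
      ∃ par', IsParent Γ par' ∧ Layout Γ par' s' ∧ ((s'.reg 11 = 0 ∧ IsNormal Γ par') ∨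
        (s'.reg 11 = 1 ∧ totalDepth n par < totalDepth n par'))) := by
  refine (ends_forPairs (n := n) (J := fun m s' => ∃ par', IsParent Γ par' ∧ Layout Γ par' s' ∧
    ((s'.reg 11 = 0 ∧ par' = par ∧ ∀ i < n, ∀ j < n, m ≤ n * i + j → Γ.adjNat (i + 1) (j + 1) →
      depth par (j + 1) ≤ depth par (i + 1) → ∃ k, par^[k] (i + 1) = j + 1) ∨
      (s'.reg 11 = 1 ∧ totalDepth n par < totalDepth n par'))) ?_ ?_ ?_ ?_).mono le_rfl ?_
  · rintro m s₁ s₂ ⟨par', hp, hl, hor⟩ hm hr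
    refine ⟨par', hp, hl.congr hm (by simp [hr]) (by simp [hr]) (by simp [hr]), ?_⟩
    rwa [hr 11 (by decide) (by decide) (by decide)]
  · rintro m s₁ ⟨par', hp, hl, hor⟩
    exact ⟨hl.1, hl.2, hl.3⟩
  · rintro i hi j hj s₁ ⟨par', hp, hl, hor⟩ h4 h5 h6
    refine (ends_improve hp hl hi hj h4 h5 h6).mono le_rfl ?_
    rintro s₂ ⟨par'', hp2, hl2, h24, h25, h26, hor2⟩
    refine ⟨⟨par'', hp2, hl2, ?_⟩, h24, h25, h26⟩
    rcases hor with ⟨hf, rfl, hall⟩ | ⟨hf, hlt⟩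
    · refine hor2.imp ?_ id
      rintro ⟨hf2, rfl, hone⟩
      refine ⟨hf2.trans hf, rfl, fun i' hi' j' hj' hle => ?_⟩
      rcases hle.eq_or_lt with heq | hlt
      · obtain ⟨rfl, rfl⟩ := index_inj hj hj' heq
        exact hone
      · exact hall i' hi' j' hj' hlt
    · right
      rcases hor2 with ⟨hf2, rfl, -⟩ | ⟨hf2, hlt2⟩
      · exact ⟨hf2.trans hf, hlt⟩
      · exact ⟨hf2, hlt.trans hlt2⟩
  · refine ⟨par, h, hs, .inl ⟨h11, rfl, fun i hi j hj hle => ?_⟩⟩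
    have : n * i + j < n * n := by nlinarith
    omega
  · rintro s₁ ⟨par', hp, hl, hor⟩
    refine ⟨par', hp, hl, hor.imp_left ?_⟩
    rintro ⟨hf, rfl, hall⟩
    refine ⟨hf, ?_⟩
    rintro _ _ ⟨i, j, hij, rfl, rfl⟩ hd
    exact hall i i.2 j j.2 (Nat.zero_le _) ⟨i, j, hij, rfl, rfl⟩ hd

lemma ends_buildForest (h : IsParent Γ par) (hs : Layout Γ par s) (h11 : s.reg 11 ≠ 0) :
    Ends buildForest s (((n + 1) * n + 1) * (n * (n * (n * 40 + 60 + 9) + 10) + 12) + 1)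
      (fun s' => ∃ par', IsParent Γ par' ∧ Layout Γ par' s' ∧ IsNormal Γ par') := by
  refine ends_loop (T := n * (n * (n * 40 + 60 + 9) + 10) + 11)
    (I := fun m s' => ∃ par', IsParent Γ par' ∧ Layout Γ par' s' ∧
      ((s'.reg 11 = 0 ∧ IsNormal Γ par') ∨
        (s'.reg 11 ≠ 0 ∧ m + totalDepth n par' = (n + 1) * n + 1))) ?_ ?_ _ s ?_ |>.le
    (T₁ := ((n + 1) * n + 1 - totalDepth n par) *
      (n * (n * (n * 40 + 60 + 9) + 10) + 11 + 1) + 1) ?_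
  · rintro m s₁ ⟨par₁, hp, hl, hor⟩ h0
    rcases hor with ⟨h0', -⟩ | ⟨-, hm⟩
    · exact absurd h0' h0
    have hle := hp.totalDepth_le
    refine ((ends_block (Q := fun s' => Layout Γ par₁ s' ∧ s'.reg 11 = 0) ?_).seq
      fun s₂ ⟨hl2, h2⟩ => ends_improve_forPairs hp hl2 h2).mono
      (by simp only [List.length_cons, List.length_nil]; omega) ?_
    · exact ⟨hl.congr rfl (by simp [Instr.exec]) (by simp [Instr.exec]) (by simp [Instr.exec]),
        by simp [Instr.exec]⟩
    · rintro s₃ ⟨par₃, hp3, hl3, h3⟩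
      have hle3 := hp3.totalDepth_le
      rcases h3 with h3 | ⟨h3, hlt⟩
      · exact ⟨0, by omega, par₃, hp3, hl3, .inl h3⟩
      · exact ⟨(n + 1) * n + 1 - totalDepth n par₃, by omega, par₃, hp3, hl3,
          .inr ⟨by omega, by omega⟩⟩
  · rintro m s₁ ⟨par₁, hp, hl, hor⟩ h0
    rcases hor with ⟨-, hN⟩ | ⟨h0', -⟩
    · exact ⟨par₁, hp, hl, hN⟩
    · exact absurd h0 h0'
  · have hle := h.totalDepth_le
    exact ⟨par, h, hs, .inr ⟨h11, by omega⟩⟩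
  · gcongr
    omega

/-- `best` is the largest number of vertices, and `u` a lowest vertex, of a cycle that consists of
an edge of `Γ` and a path to an ancestor; `best = 2` stands for the absence of such cycles. Only
the edges with an index of at least `m` are taken into account. -/
def IsBest (Γ : SimpleGraph (Fin n)) (par : ℕ → ℕ) (m best u : ℕ) : Prop :=
  u ≤ n ∧ (best = 2 ∨ ∃ k, 2 ≤ k ∧ best = k + 1 ∧ Γ.adjNat u (par^[k] u)) ∧
    ∀ i < n, ∀ j < n, m ≤ n * i + j → Γ.adjNat (i + 1) (j + 1) →
      ∀ k, par^[k] (i + 1) = j + 1 → k + 1 ≤ best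

/-- Updates the record `R[12]` for the length of a cycle, and its lowest vertex `R[13]`, at the
current pair of vertices. -/
def record : Prog :=
  .seq (block [.load 10 6]) (.ite 10
    (.seq (block [.copy 7 4, .const 8 0, .const 9 0])
    (.seq climb
    (.seq (block [.sub 10 9 12])
      (.ite 10 (block [.copy 12 9, .copy 13 4]) .skip))))
    .skip)

lemma ends_record (h : IsParent Γ par) (hs : Layout Γ par s) {i j : ℕ} (hi : i < n) (hj : j < n)
    (h4 : s.reg 4 = i + 1) (h5 : s.reg 5 = j + 1) (h6 : s.reg 6 = n * i + j)
    (hb : IsBest Γ par (n * i + j + 1) (s.reg 12) (s.reg 13)) :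
    Ends record s (n * 20 + 40) (fun s' => (Layout Γ par s' ∧
      IsBest Γ par (n * i + j) (s'.reg 12) (s'.reg 13)) ∧
      s'.reg 4 = i + 1 ∧ s'.reg 5 = j + 1 ∧ s'.reg 6 = n * i + j) := by
  have hij := hs.adj i hi j hj
  have step : ∀ best, s.reg 12 ≤ best → (Γ.adjNat (i + 1) (j + 1) →
      ∀ k, par^[k] (i + 1) = j + 1 → k + 1 ≤ best) → ∀ i' < n, ∀ j' < n, n * i + j ≤ n * i' + j' →
      Γ.adjNat (i' + 1) (j' + 1) → ∀ k, par^[k] (i' + 1) = j' + 1 → k + 1 ≤ best := by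
    intro best hle hone i' hi' j' hj' hidx hadj k hk
    rcases hidx.eq_or_lt with heq | hlt
    · obtain ⟨rfl, rfl⟩ := index_inj hj hj' heq
      exact hone hadj k hk
    · exact (hb.2.2 i' hi' j' hj' hlt hadj k hk).trans hle
  refine ((ends_block (Q := fun s' => s'.mem = s.mem ∧ (∀ r, r ≠ 10 → s'.reg r = s.reg r) ∧
    (s'.reg 10 ≠ 0 ↔ Γ.adjNat (i + 1) (j + 1))) ?_).seq fun s₁ ⟨hm1, hr1, h10⟩ =>
    ends_ite (T := n * 20 + 30) (fun hadj => ?_) fun hadj => Ends.le (ends_skip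
      ⟨⟨?_, ?_⟩, ?_, ?_, ?_⟩) (by omega)).le
      (by simp only [List.length_cons, List.length_nil]; omega)
  · refine ⟨rfl, fun r hr => ?_, ?_⟩
    · simp [Instr.exec, hr]
    · simpa [Instr.exec, h6] using hij
  · have hadj' := h10.1 hadj
    refine ((ends_block (Q := fun s' => s'.mem = s.mem ∧
      (∀ r, r ≠ 7 → r ≠ 8 → r ≠ 9 → r ≠ 10 → r ≠ 16 → s'.reg r = s.reg r) ∧
      s'.reg 7 = i + 1 ∧ s'.reg 8 = 0 ∧ s'.reg 9 = 0) ?_).seq fun s₂ ⟨hm2, hr2, h27, h28, h29⟩ =>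
      (ends_climb (s := s₂) (u := i + 1) (v := j + 1) h ?_ (by omega) (by omega) ?_ h27 h28 h29).seq
      fun s₃ ⟨hm3, hr3, h38, h39⟩ =>
      (ends_block (Q := fun s' => s'.mem = s.mem ∧
      (∀ r, r ≠ 7 → r ≠ 8 → r ≠ 9 → r ≠ 10 → r ≠ 16 → s'.reg r = s.reg r) ∧
      s'.reg 9 = s₃.reg 9 ∧ s'.reg 10 = s₃.reg 9 - s.reg 12) ?_).seq
      fun s₄ ⟨hm4, hr4, h49, h410⟩ => ends_ite (T := 5)
        (fun h0 => ends_block ?_)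
        fun h0 => Ends.le (ends_skip ?_) (by omega)).le
      (by simp only [List.length_cons, List.length_nil]; omega)
    · refine ⟨hm1, fun r _ _ _ _ _ => ?_, ?_, ?_, ?_⟩
      · simp [Instr.exec, *]
      · simp [Instr.exec, hr1, h4]
      · simp [Instr.exec]
      · simp [Instr.exec]
    · exact hs.congr hm2 (by simp [hr2]) (by simp [hr2]) (by simp [hr2])
    · simp [hr2, h5]
    · refine ⟨hm3.trans hm2, fun r _ _ _ _ _ => ?_, ?_, ?_⟩
      · simp [Instr.exec, *]
      · simp [Instr.exec]
      · simp [Instr.exec, hr3, hr2]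
    · have h2 : 2 ≤ s.reg 12 := by
        rcases hb.2.1 with hb | ⟨k, hk, hb, -⟩ <;> omega
      rcases h39 with ⟨hpos, -⟩ | ⟨k, hpos, hk⟩
      · omega
      refine ⟨⟨hs.congr hm4 (by simp [Instr.exec, hr4]) (by simp [Instr.exec, hr4])
        (by simp [Instr.exec, hr4]), ?_⟩, ?_⟩
      · have e12 : ([Instr.copy 12 9, .copy 13 4].foldl (fun s a => a.exec s) s₄).reg 12
            = k + 1 := by simp [Instr.exec, h49, hpos]
        have e13 : ([Instr.copy 12 9, .copy 13 4].foldl (fun s a => a.exec s) s₄).reg 13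
            = i + 1 := by simp [Instr.exec, hr4, h4]
        rw [e12, e13]
        refine ⟨by omega, .inr ⟨k, by omega, rfl, hk ▸ hadj'⟩, step _ (by omega) fun _ k' hk' => ?_⟩
        rw [h.iterate_inj (by rw [hk']; omega) (hk'.trans hk.symm)]
      · simp [Instr.exec, hr4, h4, h5, h6]
    · refine ⟨⟨hs.congr hm4 (by simp [hr4]) (by simp [hr4]) (by simp [hr4]), ?_⟩,
        by simp [hr4, h4, h5, h6]⟩
      rw [hr4 12 (by decide) (by decide) (by decide) (by decide) (by decide),
        hr4 13 (by decide) (by decide) (by decide) (by decide) (by decide)]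
      refine ⟨hb.1, hb.2.1, step _ le_rfl fun _ k' hk' => ?_⟩
      rcases h39 with ⟨-, hno⟩ | ⟨k, hpos, hk⟩
      · exact absurd hk' (hno k')
      · rw [h.iterate_inj (by rw [hk']; omega) (hk'.trans hk.symm)]
        omega
  · exact hs.congr hm1 (by simp [hr1]) (by simp [hr1]) (by simp [hr1])
  · rw [hr1 12 (by decide), hr1 13 (by decide)]
    exact ⟨hb.1, hb.2.1, step _ le_rfl fun hadj' => absurd hadj (h10.2 hadj')⟩
  · simp [hr1, h4]
  · simp [hr1, h5]
  · simp [hr1, h6]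

lemma ends_record_forPairs (h : IsParent Γ par) (hs : Layout Γ par s) (h12 : s.reg 12 = 2)
    (h13 : s.reg 13 = 0) :
    Ends (forPairs record) s (n * (n * (n * 20 + 40 + 9) + 10) + 7) (fun s' =>
      Layout Γ par s' ∧ IsBest Γ par 0 (s'.reg 12) (s'.reg 13)) := by
  refine ends_forPairs (n := n) (J := fun m s' => Layout Γ par s' ∧
    IsBest Γ par m (s'.reg 12) (s'.reg 13)) ?_ ?_ ?_ ⟨hs, ?_, .inl h12, ?_⟩
  · rintro m s₁ s₂ ⟨hl, hb⟩ hm hr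
    refine ⟨hl.congr hm (by simp [hr]) (by simp [hr]) (by simp [hr]), ?_⟩
    rwa [hr 12 (by decide) (by decide) (by decide), hr 13 (by decide) (by decide) (by decide)]
  · rintro m s₁ ⟨hl, hb⟩
    exact ⟨hl.1, hl.2, hl.3⟩
  · rintro i hi j hj s₁ ⟨hl, hb⟩ h4 h5 h6
    exact ends_record h hl hi hj h4 h5 h6 hb
  · omega
  · intro i hi j hj hle
    have : n * i + j < n * n := by nlinarith
    omega

/-- Writes `R[12]` vertices, from `R[13]` on towards the root, and numbered from `0` on again, to
the memory after the parent function. -/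
def writeOutput : Prog :=
  .seq (block [.copy 7 13, .copy 8 12, .add 1 3 0, .add 1 1 2, .copy 9 1])
    (.seq (.loop 8 (block [.sub 10 7 2, .store 9 10, .add 10 3 7, .load 7 10, .add 9 9 2,
      .sub 8 8 2])) (block [.copy 0 12]))

lemma ends_writeOutput (h : IsParent Γ par) (hs : Layout Γ par s) (hu : s.reg 13 ≤ n) :
    Ends writeOutput s (s.reg 12 * 14 + 20) (fun s' =>
      s'.output = (List.range (s.reg 12)).map fun i => par^[i] (s.reg 13) - 1) := by
  obtain ⟨e0, e2, e3, eadj, epar⟩ := id hs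
  refine ((ends_block (Q := fun s' => s'.mem = s.mem ∧ s'.reg 2 = 1 ∧ s'.reg 3 = n * n ∧
    s'.reg 12 = s.reg 12 ∧ s'.reg 1 = n * n + n + 1 ∧ s'.reg 7 = s.reg 13 ∧
    s'.reg 8 = s.reg 12 ∧ s'.reg 9 = n * n + n + 1) ?_).seq
    fun s₁ ⟨hm1, h12, h13, h112, h11, h17, h18, h19⟩ => (ends_loop (T := 13)
    (I := fun m s' => s'.reg 2 = 1 ∧ s'.reg 3 = n * n ∧ s'.reg 12 = s.reg 12 ∧
      s'.reg 1 = n * n + n + 1 ∧ s'.reg 8 = m ∧ ∃ i, i + m = s.reg 12 ∧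
      s'.reg 9 = n * n + n + 1 + i ∧ s'.reg 7 = par^[i] (s.reg 13) ∧
      (∀ v ≤ n, s'.mem (n * n + v) = par v) ∧
      ∀ k < i, s'.mem (n * n + n + 1 + k) = par^[k] (s.reg 13) - 1)
    (Q := fun s' => s'.reg 12 = s.reg 12 ∧ s'.reg 1 = n * n + n + 1 ∧
      ∀ k < s.reg 12, s'.mem (n * n + n + 1 + k) = par^[k] (s.reg 13) - 1) ?_ ?_ _ s₁
      ⟨h12, h13, h112, h11, h18, 0, by omega, h19, h17, hm1 ▸ epar, by simp⟩).seq
    fun s₂ ⟨h212, h21, hmem⟩ => ends_block ?_).le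
    (by simp only [List.length_cons, List.length_nil]; omega)
  · simp [Instr.exec, e0, e2, e3]
  · rintro m s₂ ⟨h22, h23, h212, h21, h28, i, him, h29, h27, hpar, hout⟩ h0
    refine (ends_block ?_).le (by simp only [List.length_cons, List.length_nil]; omega)
    refine ⟨m - 1, by omega, ?_, ?_, ?_, ?_, ?_, i + 1, by omega, ?_, ?_, ?_, ?_⟩
    · simp [Instr.exec, h22]
    · simp [Instr.exec, h23]
    · simp [Instr.exec, h212]
    · simp [Instr.exec, h21]
    · simp [Instr.exec, h28, h22]
    · simp [Instr.exec, h29, h22]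
      omega
    · have hle := h.iterate_le hu i
      have hne : n * n + par^[i] (s.reg 13) ≠ n * n + n + 1 + i := by omega
      simp [Instr.exec, h23, h27, h29, Function.update_of_ne hne, hpar _ hle,
        Function.iterate_succ_apply']
    · intro v hv
      have hne : n * n + v ≠ n * n + n + 1 + i := by omega
      simp [Instr.exec, h29, Function.update_of_ne hne, hpar v hv]
    · intro k hk
      rcases Nat.lt_succ_iff_lt_or_eq.1 hk with hk | rfl
      · have hne : n * n + n + 1 + k ≠ n * n + n + 1 + i := by omega
        simp [Instr.exec, h29, Function.update_of_ne hne, hout k hk]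
      · simp [Instr.exec, h29, h27, h22]
  · rintro m s₂ ⟨h22, h23, h212, h21, h28, i, him, h29, h27, hpar, hout⟩ h0
    exact ⟨h212, h21, fun k hk => hout k (by omega)⟩
  · rw [State.output]
    have e0' : ([Instr.copy 0 12].foldl (fun s a => a.exec s) s₂).reg 0 = s.reg 12 := by
      simp [Instr.exec, h212]
    have e1' : ([Instr.copy 0 12].foldl (fun s a => a.exec s) s₂).reg 1 = n * n + n + 1 := by
      simp [Instr.exec, h21]
    have em : ([Instr.copy 0 12].foldl (fun s a => a.exec s) s₂).mem = s₂.mem := rfl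
    rw [e0', e1', em]
    exact List.map_congr_left fun k hk => hmem k (List.mem_range.1 hk)

/-- Sets `R[2]`, `R[3]` and `R[11]` to `1`, `n * n` and `1`. -/
def setup : Prog :=
  .seq (block [.const 2 1, .const 11 1, .copy 8 0])
    (.loop 8 (block [.add 3 3 0, .sub 8 8 2]))

/-- Grow a normal forest from the forest without edges, find the longest cycle that consists of an
edge and a path to an ancestor, and write it down. -/
def longCycle : Prog :=
  .seq setup (.seq buildForest (.seq (block [.const 12 2, .const 13 0])
    (.seq (forPairs record) writeOutput)))

lemma ends_setup [DecidableRel Γ.Adj] :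
    Ends setup (graphInput Γ) (n * 6 + 20)
      (fun s => Layout Γ (fun _ => 0) s ∧ s.reg 11 ≠ 0) := by
  refine ((ends_block (Q := fun s => s.mem = (graphInput Γ).mem ∧ s.reg 0 = n ∧ s.reg 2 = 1 ∧
    s.reg 3 = 0 ∧ s.reg 11 = 1 ∧ s.reg 8 = n) ?_).seq
    fun s₁ ⟨hm1, h10, h12, h13, h111, h18⟩ => ends_loop (T := 5)
    (I := fun m s => s.mem = (graphInput Γ).mem ∧ s.reg 0 = n ∧ s.reg 2 = 1 ∧
      s.reg 3 + n * m = n * n ∧ s.reg 11 = 1 ∧ s.reg 8 = m) ?_ ?_ n s₁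
      ⟨hm1, h10, h12, by simp [h13], h111, h18⟩).le
    (by simp only [List.length_cons, List.length_nil]; omega)
  · simp [Instr.exec, graphInput]
  · rintro m s ⟨hm, h0, h2, h3, h11, h8⟩ hne
    obtain ⟨m, rfl⟩ : ∃ l, m = l + 1 := ⟨m - 1, by omega⟩
    refine (ends_block ?_).le (by simp only [List.length_cons, List.length_nil]; omega)
    refine ⟨m, by omega, hm, ?_⟩
    simp [Instr.exec, h0, h2, h11, h8, ← h3]
    ring
  · rintro m s ⟨hm, h0, h2, h3, h11, h8⟩ hne
    obtain rfl : m = 0 := by omega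
    refine ⟨⟨h0, h2, by simpa using h3, fun i hi j hj => ?_, fun v hv => ?_⟩, by omega⟩
    · simp only [hm, graphInput, ne_eq, ite_eq_right_iff, one_ne_zero, imp_false, not_not]
      constructor
      · rintro ⟨a, b, hab, heq⟩
        obtain ⟨rfl, rfl⟩ := index_inj hj b.2 heq
        exact ⟨a, b, hab, rfl, rfl⟩
      · rintro ⟨a, b, hab, ha, hb⟩
        refine ⟨a, b, hab, ?_⟩
        rw [Nat.succ_injective ha, Nat.succ_injective hb]
    · simp only [hm, graphInput, ite_eq_right_iff, one_ne_zero, imp_false]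
      rintro ⟨a, b, -, heq⟩
      have : n * (a : ℕ) + b < n * n := by
        have := a.2
        have := b.2
        nlinarith
      omega

lemma IsBest.le {m best u : ℕ} (hn : IsParent Γ par) (hb : IsBest Γ par m best u) :
    best ≤ n + 2 := by
  rcases hb.2.1 with hb | ⟨k, -, hk, hadj⟩
  · omega
  · have hp := IsParent.adjNat_pos hadj
    have := hn.depth_le hp.2.1
    have : ¬ depth par u ≤ k := fun hle => hp.2.2.1.ne' (hn.iterate_eq_zero.2 hle)
    omega

/-- A polynomial bound for the number of steps of `longCycle`. -/
noncomputable def timeBound : Polynomial ℕ :=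
  let X : Polynomial ℕ := Polynomial.X
  (X * 6 + 20) + (((X + 1) * X + 1) * (X * (X * (X * 40 + 60 + 9) + 10) + 12) + 1) +
    (X * (X * (X * 20 + 40 + 9) + 10) + 7) + ((X + 2) * 14 + 20) + 20

theorem ends_longCycle [DecidableRel Γ.Adj] :
    Ends longCycle (graphInput Γ) (timeBound.eval n) (fun s => ∃ par best u, IsParent Γ par ∧
      IsNormal Γ par ∧ IsBest Γ par 0 best u ∧
      s.output = (List.range best).map fun i => par^[i] u - 1) := by
  refine (ends_setup.seq fun s₁ ⟨hl1, h111⟩ =>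
    (ends_buildForest IsParent.of_zero hl1 h111).seq fun s₂ ⟨par, hp, hl2, hN⟩ =>
    (ends_block (Q := fun s => Layout Γ par s ∧ s.reg 12 = 2 ∧ s.reg 13 = 0) ?_).seq fun s₃ ⟨hl3, h312, h313⟩ =>
    (ends_record_forPairs hp hl3 h312 h313).seq fun s₄ ⟨hl4, hb⟩ =>
    (ends_writeOutput hp hl4 ?_).mono (T₂ := (n + 2) * 14 + 20) ?_
      fun s₅ h5 => ⟨par, s₄.reg 12, s₄.reg 13, hp, hN, hb, h5⟩).le ?_
  · exact ⟨hl2.congr rfl (by simp [Instr.exec]) (by simp [Instr.exec]) (by simp [Instr.exec]),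
      by simp [Instr.exec]⟩
  · exact hb.1
  · have := hb.le hp
    omega
  · simp [timeBound]
    omega

end RAM

/-! ### Cycles from chains of ancestors -/

/-- Besides the vertices, the edges are recorded in order to tell that the closing edge of a cycle
is a new one. -/
lemma SimpleGraph.exists_walk_of_seq {V : Type*} {G : SimpleGraph V} (f : ℕ → V) (m : ℕ)
    (hf : ∀ i < m, G.Adj (f i) (f (i + 1))) :
    ∃ p : G.Walk (f 0) (f m), p.support = (List.range (m + 1)).map f ∧
      p.edges = (List.range m).map fun i => s(f i, f (i + 1)) := by
  induction m generalizing f with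
  | zero => exact ⟨.nil, by simp, by simp⟩
  | succ m ih =>
    obtain ⟨p, hp, he⟩ := ih (fun i => f (i + 1)) fun i hi => hf (i + 1) (by omega)
    refine ⟨.cons (hf 0 (by omega)) p, ?_, ?_⟩
    · rw [SimpleGraph.Walk.support_cons, hp, List.range_succ_eq_map (n := m + 1)]
      simp [Function.comp_def]
    · rw [SimpleGraph.Walk.edges_cons, he, List.range_succ_eq_map (n := m)]
      simp [Function.comp_def]

lemma SimpleGraph.exists_cycle_of_seq {V : Type*} {G : SimpleGraph V} (f : ℕ → V) {m : ℕ}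
    (hm : 2 ≤ m) (hf : ∀ i < m, G.Adj (f i) (f (i + 1))) (hclose : G.Adj (f m) (f 0))
    (hinj : Set.InjOn f (Set.Iic m)) :
    ∃ c : G.Walk (f m) (f m), c.IsCycle ∧ c.support.tail = (List.range (m + 1)).map f ∧
      c.length = m + 1 := by
  obtain ⟨p, hp, he⟩ := SimpleGraph.exists_walk_of_seq f m hf
  refine ⟨.cons hclose p, ?_, by simp [hp], ?_⟩
  · rw [SimpleGraph.Walk.cons_isCycle_iff, SimpleGraph.Walk.isPath_def, hp, he]
    constructor
    · refine List.Nodup.map_on (fun i hi j hj hij => hinj ?_ ?_ hij) List.nodup_range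
      · simpa [Nat.lt_succ_iff] using hi
      · simpa [Nat.lt_succ_iff] using hj
    · simp only [List.mem_map, List.mem_range, not_exists, not_and]
      intro i hi heq
      rw [Sym2.eq_iff] at heq
      rcases heq with ⟨h1, -⟩ | ⟨h1, h2⟩
      · have := hinj (by simp; omega) (by simp) h1
        omega
      · have := hinj (by simp; omega) (by simp) h1
        have := hinj (by simp; omega) (by simp) h2
        omega
  · have := SimpleGraph.Walk.length_support p
    rw [hp] at this
    simp at this
    simp [this]

lemma IsParent.exists_cycle {n : ℕ} {Γ : SimpleGraph (Fin n)} {par : ℕ → ℕ}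
    (h : IsParent Γ par) {u k : ℕ} (hk : 2 ≤ k) (hadj : Γ.adjNat u (par^[k] u)) :
    ∃ (v : Fin n) (c : Γ.Walk v v), c.IsCycle ∧
      ((List.range (k + 1)).map fun i => par^[i] u - 1) =
        c.support.tail.map (fun w : Fin n => (w : ℕ)) ∧ c.length = k + 1 := by
  have hpos := adjNat_pos hadj
  have hn : 0 < n := by omega
  have hne : ∀ i ≤ k, par^[i] u ≠ 0 := by
    intro i hi h0
    have h1 := h.iterate_eq_zero.1 h0
    have := h.iterate_eq_zero.2 (h1.trans hi)
    omega
  have hle : ∀ i, par^[i] u ≤ n := h.iterate_le hpos.2.1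
  let f : ℕ → Fin n := fun i => ⟨par^[i] u - 1, by have := hle i; omega⟩
  have hf : ∀ i ≤ k, (f i : ℕ) + 1 = par^[i] u := by
    intro i hi
    have := hne i hi
    simp only [f]
    omega
  have hadjf : ∀ i ≤ k, ∀ j ≤ k, Γ.adjNat (par^[i] u) (par^[j] u) → Γ.Adj (f i) (f j) := by
    rintro i hi j hj ⟨a, b, hab, ha, hb⟩
    rwa [← Fin.ext (a := a) (b := f i) (by have := hf i hi; omega),
      ← Fin.ext (a := b) (b := f j) (by have := hf j hj; omega)]
  have hstep : ∀ i < k, Γ.Adj (f i) (f (i + 1)) := by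
    intro i hi
    refine hadjf i hi.le (i + 1) hi ?_
    have := hne (i + 1) hi
    rw [Function.iterate_succ_apply'] at this ⊢
    exact h.adj _ this
  have hclose : Γ.Adj (f k) (f 0) := hadjf k le_rfl 0 (Nat.zero_le k) (adjNat_symm hadj)
  have hinj : Set.InjOn f (Set.Iic k) := by
    intro i hi j hj hij
    refine h.iterate_inj (hne i hi) ?_
    rw [← hf i hi, ← hf j hj, hij]
  obtain ⟨c, hc, hsupp, hlen⟩ := SimpleGraph.exists_cycle_of_seq f hk hstep hclose hinj
  exact ⟨f k, c, hc, by simp [hsupp, f], hlen⟩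

/-! ### Length of the cycle found -/

theorem mainTheorem3 :
    ∃ (P : RAM.Prog) (p : Polynomial ℕ),
      ∀ (n : ℕ) (Γ : SimpleGraph (Fin n)) [DecidableRel Γ.Adj],
        ∃ s : RAM.State, RAM.HaltsWithin P (RAM.graphInput Γ) (p.eval n) s ∧
          ∀ (ε : ℝ) (D τ : ℕ), 0 < ε → ε < 2 / 5 → 0 < n → 0 < D → 0 < τ →
            Γ.IsRegularOfDegree D →
            ε * (n : ℝ) ≤
              ({v : Fin n | tvDist (walkDist Γ v τ) (unifDist n) < 1 / 30}.ncard : ℝ) →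
            ∃ (v : Fin n) (c : Γ.Walk v v), c.IsCycle ∧
              s.output = c.support.tail.map (fun u : Fin n => (u : ℕ)) ∧
              ε * (n : ℝ) / (40 * (τ : ℝ)) < (c.length : ℝ) := by
  refine ⟨RAM.longCycle, RAM.timeBound, fun n Γ _ => ?_⟩
  obtain ⟨s, hs, par, best, u, hp, hN, hb, hout⟩ := (RAM.ends_longCycle (Γ := Γ)).haltsWithin
  refine ⟨s, hs, fun ε D τ hε _ hn hD hτ hreg hmix => ?_⟩
  have hn' : (0 : ℝ) < n := by exact_mod_cast hn
  have hτ' : (1 : ℝ) ≤ τ := by exact_mod_cast hτ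
  -- with degree `1` no walk mixes, so that `hmix` fails
  have hD2 : 2 ≤ D := by
    by_contra hlt
    obtain rfl : D = 1 := by omega
    have : {v : Fin n | tvDist (walkDist Γ v τ) (unifDist n) < 1 / 30} = ∅ :=
      Set.eq_empty_of_forall_notMem fun v hv => hv.not_ge (le_tvDist_of_matching hreg v τ)
    rw [this, Set.ncard_empty, Nat.cast_zero] at hmix
    exact absurd hmix (not_le.2 (mul_pos hε hn'))
  have hspan : ∀ u k, Γ.adjNat u (par^[k] u) → k < best := by
    rintro w k ⟨i, j, hij, hi, hj⟩
    have := hb.2.2 i i.2 j j.2 (Nat.zero_le _) ⟨i, j, hij, rfl, rfl⟩ k (by rw [hi, hj])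
    omega
  obtain ⟨k, hk2, rfl, hadj⟩ : ∃ k, 2 ≤ k ∧ best = k + 1 ∧ Γ.adjNat u (par^[k] u) := by
    refine hb.2.1.resolve_left ?_
    intro h2
    obtain ⟨w, k, hk, hwk⟩ := hN.exists_long_back_edge hD2 hn hreg
    have := hspan w k hwk
    omega
  obtain ⟨v, c, hc, hsupp, hlen⟩ := hp.exists_cycle hk2 hadj
  refine ⟨v, c, hc, hout.trans hsupp, ?_⟩
  obtain ⟨S, col, hS, hcol, hsize⟩ := hp.exists_separator hN (Nat.succ_pos k) hspan
  have hcard := card_mixing_le hn hD hreg hcol hsize τ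
  have hS' : (S.card : ℝ) ≤ c.length := by rw [hlen]; exact_mod_cast hS
  have hpos : (0 : ℝ) < c.length := by rw [hlen]; positivity
  rw [div_lt_iff₀ (by positivity)]
  -- as `τ + 1 ≤ 2 * τ`, the bound holds even with `60 / 13` in place of `40`
  have h1 : (τ + 1 : ℝ) * S.card ≤ (2 * τ) * c.length := by gcongr; linarith
  have h2 : 0 < τ * (c.length : ℝ) := by positivity
  linarith
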